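/- Fix a set of built-in unitary gates of arity $1$ or $2$ (a gate $A$ of arity $k$ is a unitary $2^k\times 2^k$ matrix). Terms of the untyped quantum $\lambda$-calculus, taken modulo $\alpha$-equivalence, are $$M,N,P ::= x \mid {!M} \mid \lambda x.M \mid \lambda^! x.M \mid MN \mid r_i \mid U_A \mid \mathsf{new} \mid \mathsf{meas}(P,M,N),$$ with registers $r_i$, $i\in\mathbb N$; $\langle M,N\rangle$ stands for $\lambda f.fMN$. Surface contexts are $S ::= [\,] \mid MS \mid SM \mid \lambda x.S \mid \lambda^! x.S \mid \mathsf{meas}(S,M,N)$, and an occurrence of $T$ in $S[T]$ is called surface. A term is valid if every register occurs at most once in it, all occurrences of registers are surface, and for each subterm $\lambda x.P$ the variable $x$ occurs free exactly once in $P$, at a surface position. A raw program is a pair $[Q,M]$ of a normalized vector $Q\in(\mathbb C^2)^{\otimes n}$ and a valid term $M$ whose set of registers is $\{r_0,\dots,r_{n-1}\}$. A program is an equivalence class of raw programs under simultaneous permutation of the qubits of $Q$ and of the registers of $M$ (for a permutation $\sigma$ of $\{0,\dots,n-1\}$, qubit $i$ becomes qubit $\sigma(i)$ and $r_i$ becomes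 $r_{\sigma(i)}$). A multidistribution is a finite multiset $\{\!\{p_i\,e_i\}\!\}_{i\in I}$ of programs $e_i$ with weights $p_i\in(0,1]$ such that $\sum_i p_i\le 1$. The root rules are \begin{align*} [Q,(\lambda x.M)N]&\mapsto\{\!\{[Q,M\{N/x\}]\}\!\},\qquad [Q,(\lambda^! x.M)\,!N]\mapsto\{\!\{[Q,M\{N/x\}]\}\!\},\\ [Q,\mathsf{new}]&\mapsto\{\!\{[Q\otimes|0\rangle,r_n]\}\!\}\quad\text{if $Q$ has $n$ qubits},\\ [Q,U_A r_0]&\mapsto\{\!\{[(A\otimes \mathrm{Id})Q,r_0]\}\!\}\quad(A\text{ unary}),\\ [Q,U_A\langle r_0,r_1\rangle]&\mapsto\{\!\{[(A\otimes \mathrm{Id})Q,\langle r_0,r_1\rangle]\}\!\}\quad(A\text{ binary}),\\ [Q,\mathsf{meas}(r_n,M,N)]&\mapsto\{\!\{|\alpha_0|^2[Q_0,M],\,|\alpha_1|^2[Q_1,N]\}\!\}, \end{align*} the last one whenever $Q$ has $n+1$ qubits and $Q=\alpha_0Q_0\otimes|0\rangle+\alpha_1Q_1\otimes|1\rangle$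 with $\alpha_0,\alpha_1\in\mathbb C$ and $Q_0,Q_1$ normalized, where an outcome of weight $0$ is omitted. A surface step $e\to_s m$, from a program to a multidistribution, applies a root rule inside a surface context in some representative of $e$; $e$ is a surface normal form if there is no surface step from it. Strict surface reduction $\Rightarrow_s$ on multidistributions is defined by: $\{\!\{p_i\,e_i\}\!\}_{i\in I}\Rightarrow_s\sum_{i\in I}p_i\cdot m_i$ whenever, for each $i$, either $e_i\to_s m_i$, or $e_i$ is a surface normal form and $m_i=\{\!\{1\,e_i\}\!\}$. Let $\Pr(m)$ be the sum of the weights in $m$ of the programs that are surface normal forms. Theorem (Random Descent). For every multidistribution $m$ there is $q\in[0,1]$ such that every infinite sequence $m=m_0\Rightarrow_s m_1\Rightarrow_s m_2\Rightarrow_s\cdots$ converges with probability $q$, that is, $\lim_{k\to\infty}\Pr(m_k)=\sup_k\Pr(m_k)=q$. -/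

import Mathlib

universe u

noncomputable section

namespace QLam

/-! ### Quantum memories -/

/-- The space `(ℂ²)^{⊗ n}`, in coordinates with respect to the basis `|b₀ … b_{n-1}⟩`. -/
abbrev QVec (n : ℕ) : Type := EuclideanSpace ℂ (Fin n → Fin 2)

namespace QVec

/-- `Q ⊗ |c⟩`: the new qubit is the last one. -/
def tensorKet {n : ℕ} (Q : QVec n) (c : Fin 2) : QVec (n + 1) :=
  WithLp.toLp 2 fun b => if b (Fin.last n) = c then Q (fun i => b i.castSucc) else 0

/-- `(A ⊗ Id) Q` for a `2 × 2` matrix `A`, acting on qubit `0`. -/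
def apply1 {n : ℕ} (A : Matrix (Fin 2) (Fin 2) ℂ) (Q : QVec (n + 1)) : QVec (n + 1) :=
  WithLp.toLp 2 fun b => ∑ c : Fin 2, A (b 0) c * Q (Function.update b 0 c)

/-- `(A ⊗ Id) Q` for a `4 × 4` matrix `A` (rows and columns are indexed by pairs of bits),
acting on qubits `0` and `1`. -/
def apply2 {n : ℕ} (A : Matrix (Fin 2 × Fin 2) (Fin 2 × Fin 2) ℂ) (Q : QVec (n + 2)) :
    QVec (n + 2) :=
  WithLp.toLp 2 fun b => ∑ c : Fin 2 × Fin 2,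
    A (b 0, b 1) c * Q (Function.update (Function.update b 0 c.1) 1 c.2)

/-- The permutation of qubits: bit `i` of a basis vector becomes bit `σ i`. -/
def permute {n : ℕ} (σ : Equiv.Perm (Fin n)) (Q : QVec n) : QVec n :=
  WithLp.toLp 2 fun b => Q (fun i => b (σ i))

end QVec

/-- A set of built-in unary and binary unitary gates. -/
structure GateSet where
  Unary : Type u
  Binary : Type u
  mat1 : Unary → Matrix.unitaryGroup (Fin 2) ℂ
  mat2 : Binary → Matrix.unitaryGroup (Fin 2 × Fin 2) ℂ

/-! ### Terms -/

/-- Raw terms modulo `α`-equivalence, with de Bruijn indices for the variables. -/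
inductive Term (G : GateSet.{u}) : Type u
  | var (k : ℕ)
  | bang (M : Term G)
  /-- the linear abstraction `λ x. M` -/
  | lam (M : Term G)
  /-- the non-linear abstraction `λ! x. M` -/
  | blam (M : Term G)
  | app (M N : Term G)
  | reg (i : ℕ)
  | gate1 (A : G.Unary)
  | gate2 (A : G.Binary)
  | new
  | meas (P M N : Term G)

namespace Term

variable {G : GateSet.{u}}

/-- Lifting of a renaming of variables under a binder. -/
def upRen (ξ : ℕ → ℕ) : ℕ → ℕ
  | 0 => 0
  | k + 1 => ξ k + 1

/-- Renaming of the free variables. -/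
def rename : (ℕ → ℕ) → Term G → Term G
  | ξ, var k => var (ξ k)
  | ξ, bang M => bang (rename ξ M)
  | ξ, lam M => lam (rename (upRen ξ) M)
  | ξ, blam M => blam (rename (upRen ξ) M)
  | ξ, app M N => app (rename ξ M) (rename ξ N)
  | _, reg i => reg i
  | _, gate1 A => gate1 A
  | _, gate2 A => gate2 A
  | _, new => new
  | ξ, meas P M N => meas (rename ξ P) (rename ξ M) (rename ξ N)

/-- Lifting of a substitution under a binder. -/
def upSubst (τ : ℕ → Term G) : ℕ → Term G
  | 0 => var 0
  | k + 1 => rename Nat.succ (τ k)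

/-- Simultaneous capture-avoiding substitution of terms for the free variables. -/
def subst : (ℕ → Term G) → Term G → Term G
  | τ, var k => τ k
  | τ, bang M => bang (subst τ M)
  | τ, lam M => lam (subst (upSubst τ) M)
  | τ, blam M => blam (subst (upSubst τ) M)
  | τ, app M N => app (subst τ M) (subst τ N)
  | _, reg i => reg i
  | _, gate1 A => gate1 A
  | _, gate2 A => gate2 A
  | _, new => new
  | τ, meas P M N => meas (subst τ P) (subst τ M) (subst τ N)

/-- `M{N/x}`, where `x` is the variable with index `0` in `M`. -/
def inst (M N : Term G) : Term G :=
  subst (fun k => match k with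
    | 0 => N
    | k + 1 => var k) M

/-- The pair `⟨M, N⟩`, encoded as `λ f. f M N`. -/
def pair (M N : Term G) : Term G :=
  lam (app (app (var 0) (rename Nat.succ M)) (rename Nat.succ N))

/-- Replacement of each register `rᵢ` by `r_{f i}`. -/
def mapReg (f : ℕ → ℕ) : Term G → Term G
  | var k => var k
  | bang M => bang (mapReg f M)
  | lam M => lam (mapReg f M)
  | blam M => blam (mapReg f M)
  | app M N => app (mapReg f M) (mapReg f N)
  | reg i => reg (f i)
  | gate1 A => gate1 A
  | gate2 A => gate2 A
  | new => new
  | meas P M N => meas (mapReg f P) (mapReg f M) (mapReg f N)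

/-- Number of occurrences of the register `rᵢ`. -/
def regCount (i : ℕ) : Term G → ℕ
  | var _ => 0
  | bang M => regCount i M
  | lam M => regCount i M
  | blam M => regCount i M
  | app M N => regCount i M + regCount i N
  | reg j => if j = i then 1 else 0
  | gate1 _ => 0
  | gate2 _ => 0
  | new => 0
  | meas P M N => regCount i P + regCount i M + regCount i N

/-- Number of surface occurrences of the register `rᵢ`: those neither in the scope of a `!`
nor in a branch of a `meas`. -/
def surfRegCount (i : ℕ) : Term G → ℕ
  | var _ => 0
  | bang _ => 0
  | lam M => surfRegCount i M
  | blam M => surfRegCount i M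
  | app M N => surfRegCount i M + surfRegCount i N
  | reg j => if j = i then 1 else 0
  | gate1 _ => 0
  | gate2 _ => 0
  | new => 0
  | meas P _ _ => surfRegCount i P

/-- Number of free occurrences of the variable with index `k`. -/
def varCount : ℕ → Term G → ℕ
  | k, var j => if j = k then 1 else 0
  | k, bang M => varCount k M
  | k, lam M => varCount (k + 1) M
  | k, blam M => varCount (k + 1) M
  | k, app M N => varCount k M + varCount k N
  | _, reg _ => 0
  | _, gate1 _ => 0
  | _, gate2 _ => 0
  | _, new => 0
  | k, meas P M N => varCount k P + varCount k M + varCount k N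

/-- Number of free surface occurrences of the variable with index `k`. -/
def surfVarCount : ℕ → Term G → ℕ
  | k, var j => if j = k then 1 else 0
  | _, bang _ => 0
  | k, lam M => surfVarCount (k + 1) M
  | k, blam M => surfVarCount (k + 1) M
  | k, app M N => surfVarCount k M + surfVarCount k N
  | _, reg _ => 0
  | _, gate1 _ => 0
  | _, gate2 _ => 0
  | _, new => 0
  | k, meas P _ _ => surfVarCount k P

/-- For every subterm `λ x. P`, the variable `x` occurs free exactly once in `P`, and this
occurrence is surface. -/
def LinearAbs : Term G → Prop
  | var _ => True
  | bang M => LinearAbs M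
  | lam M => (varCount 0 M = 1 ∧ surfVarCount 0 M = 1) ∧ LinearAbs M
  | blam M => LinearAbs M
  | app M N => LinearAbs M ∧ LinearAbs N
  | reg _ => True
  | gate1 _ => True
  | gate2 _ => True
  | new => True
  | meas P M N => LinearAbs P ∧ LinearAbs M ∧ LinearAbs N

/-- Valid terms: no register occurs more than once, all occurrences of registers are surface,
and linear abstractions are linear. -/
def Valid (M : Term G) : Prop :=
  (∀ i, regCount i M ≤ 1) ∧ (∀ i, surfRegCount i M = regCount i M) ∧ LinearAbs M

end Term

/-- Surface contexts: the hole is neither in the scope of a `!` nor in a branch of a `meas`. -/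
inductive SurfCtx (G : GateSet.{u}) : Type u
  | hole
  | appR (M : Term G) (S : SurfCtx G)
  | appL (S : SurfCtx G) (M : Term G)
  | lam (S : SurfCtx G)
  | blam (S : SurfCtx G)
  | meas (S : SurfCtx G) (M N : Term G)

/-- Replacement of the hole by a term, possibly capturing free variables. -/
def SurfCtx.fill {G : GateSet.{u}} : SurfCtx G → Term G → Term G
  | hole, R => R
  | appR M S, R => .app M (S.fill R)
  | appL S M, R => .app (S.fill R) M
  | lam S, R => .lam (S.fill R)
  | blam S, R => .blam (S.fill R)
  | meas S M N, R => .meas (S.fill R) M N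

/-! ### Programs -/

/-- A pair `[Q, M]` of a vector in `(ℂ²)^{⊗ size}` and a term. -/
structure Config (G : GateSet.{u}) where
  size : ℕ
  mem : QVec size
  term : Term G

/-- The action of a permutation of `{0, …, n-1}` on register identifiers. -/
def extendPerm {n : ℕ} (σ : Equiv.Perm (Fin n)) (i : ℕ) : ℕ :=
  if h : i < n then (σ ⟨i, h⟩ : ℕ) else i

/-- The re-indexing `[σ(Q), σ(M)]`. -/
def Config.reindex {G : GateSet.{u}} (c : Config G) (σ : Equiv.Perm (Fin c.size)) : Config G :=
  ⟨c.size, c.mem.permute σ, c.term.mapReg (extendPerm σ)⟩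

/-- Raw programs: `Q` is normalized, `M` is valid and its registers are `r₀, …, r_{n-1}`. -/
structure RawProgram (G : GateSet.{u}) extends Config G where
  norm_mem : ‖mem‖ = 1
  valid : term.Valid
  regs : ∀ i, 1 ≤ term.regCount i ↔ i < size

theorem Term.mapReg_mapReg {G : GateSet.{u}} (f g : ℕ → ℕ) (M : Term G) :
    (M.mapReg f).mapReg g = M.mapReg (fun i => g (f i)) := by
  induction M <;> simp_all [Term.mapReg]

theorem Term.mapReg_id {G : GateSet.{u}} (M : Term G) : M.mapReg (fun i => i) = M := by
  induction M <;> simp_all [Term.mapReg]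

theorem extendPerm_one {n : ℕ} : extendPerm (1 : Equiv.Perm (Fin n)) = fun i => i := by
  funext i; simp [extendPerm]

theorem extendPerm_mul {n : ℕ} (σ τ : Equiv.Perm (Fin n)) :
    (fun i => extendPerm τ (extendPerm σ i)) = extendPerm (τ * σ) := by
  funext i; by_cases h : i < n <;> simp [extendPerm, h]

theorem Config.reindex_one {G : GateSet.{u}} (c : Config G) : c.reindex 1 = c := by
  cases c; simp [Config.reindex, QVec.permute, extendPerm_one, Term.mapReg_id]

theorem Config.reindex_reindex {G : GateSet.{u}} (c : Config G) (σ τ : Equiv.Perm (Fin c.size)) :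
    (c.reindex σ).reindex τ = c.reindex (τ * σ) := by
  simp only [Config.reindex, QVec.permute, Term.mapReg_mapReg, extendPerm_mul]
  rfl

/-- Equality of raw programs up to re-indexing. -/
instance RawProgram.setoid (G : GateSet.{u}) : Setoid (RawProgram G) where
  r p q := ∃ σ : Equiv.Perm (Fin p.size), q.toConfig = p.toConfig.reindex σ
  iseqv :=
    { refl := fun p => ⟨1, p.toConfig.reindex_one.symm⟩
      symm := by
        rintro ⟨p, _, _, _⟩ ⟨q, _, _, _⟩ ⟨σ, h⟩
        dsimp only at h σ ⊢
        subst h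
        refine ⟨(σ⁻¹ : Equiv.Perm (Fin p.size)), ?_⟩
        refine Eq.symm ((Config.reindex_reindex p σ σ⁻¹).trans ?_)
        rw [inv_mul_cancel, Config.reindex_one]
      trans := by
        rintro ⟨p, _, _, _⟩ ⟨q, _, _, _⟩ ⟨r, _, _, _⟩ ⟨σ, h⟩ ⟨τ, h'⟩
        dsimp only at h σ h' τ ⊢
        subst h
        exact ⟨(show Equiv.Perm (Fin p.size) from τ) * σ, h'.trans (Config.reindex_reindex p σ τ)⟩ }

/-- Programs: raw programs up to re-indexing. -/
def Program (G : GateSet.{u}) : Type u := Quotient (RawProgram.setoid G)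

/-- The program represented by a raw program. -/
def RawProgram.toProgram {G : GateSet.{u}} (p : RawProgram G) : Program G :=
  Quotient.mk (RawProgram.setoid G) p

/-! ### Multidistributions -/

/-- Multidistributions: finite multisets of weighted elements, with weights in `]0,1]` of sum at
most `1`. -/
structure MDist (α : Type u) where
  val : Multiset (ℝ × α)
  mem_Ioc : ∀ x ∈ val, x.1 ∈ Set.Ioc (0 : ℝ) 1
  sum_le_one : (val.map Prod.fst).sum ≤ 1

/-- The product of a scalar and a multiset of weighted elements. -/
def scale {α : Type u} (q : ℝ) (m : Multiset (ℝ × α)) : Multiset (ℝ × α) :=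
  m.map fun x => (q * x.1, x.2)

/-! ### Surface reduction -/

/-- The root `β` rules `(b)` and `(!b)`; they do not act on the memory. -/
inductive RootBeta {G : GateSet.{u}} : Term G → Term G → Prop
  | lin (M N : Term G) : RootBeta (.app (.lam M) N) (M.inst N)
  | bang (M N : Term G) : RootBeta (.app (.blam M) (.bang N)) (M.inst N)

/-- The root quantum rules. In the rule for measurement, outcomes of probability `0` are not
recorded, since weights in a multidistribution are positive. -/
inductive RootQuantum {G : GateSet.{u}} : Config G → Multiset (ℝ × Config G) → Prop
  | new (n : ℕ) (Q : QVec n) :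
      RootQuantum ⟨n, Q, .new⟩ {(1, ⟨n + 1, Q.tensorKet 0, .reg n⟩)}
  | meas (n : ℕ) (Q : QVec (n + 1)) (α₀ α₁ : ℂ) (Q₀ Q₁ : QVec n) (M N : Term G)
      (norm₀ : ‖Q₀‖ = 1) (norm₁ : ‖Q₁‖ = 1)
      (decomp : Q = α₀ • Q₀.tensorKet 0 + α₁ • Q₁.tensorKet 1) :
      RootQuantum ⟨n + 1, Q, .meas (.reg n) M N⟩
        (({(‖α₀‖ ^ 2, ⟨n, Q₀, M⟩), (‖α₁‖ ^ 2, ⟨n, Q₁, N⟩)} :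
          Multiset (ℝ × Config G)).filter fun x => x.1 ≠ 0)
  | unary (n : ℕ) (Q : QVec (n + 1)) (A : G.Unary) :
      RootQuantum ⟨n + 1, Q, .app (.gate1 A) (.reg 0)⟩
        {(1, ⟨n + 1, Q.apply1 (G.mat1 A).1, .reg 0⟩)}
  | binary (n : ℕ) (Q : QVec (n + 2)) (A : G.Binary) :
      RootQuantum ⟨n + 2, Q, .app (.gate2 A) (.pair (.reg 0) (.reg 1))⟩
        {(1, ⟨n + 2, Q.apply2 (G.mat2 A).1, .pair (.reg 0) (.reg 1)⟩)}

/-- Closure of the root rules under surface contexts. -/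
inductive CtxStep {G : GateSet.{u}} : Config G → Multiset (ℝ × Config G) → Prop
  | beta (n : ℕ) (Q : QVec n) (S : SurfCtx G) (M M' : Term G) (h : RootBeta M M') :
      CtxStep ⟨n, Q, S.fill M⟩ {(1, ⟨n, Q, S.fill M'⟩)}
  | quantum (n : ℕ) (Q : QVec n) (S : SurfCtx G) (M : Term G) (d : Multiset (ℝ × Config G))
      (h : RootQuantum ⟨n, Q, M⟩ d) :
      CtxStep ⟨n, Q, S.fill M⟩ (d.map fun x => (x.1, ⟨x.2.size, x.2.mem, S.fill x.2.term⟩))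

/-- Surface steps from programs to multidistributions of programs: a surface step can be
performed on any representative of the program. -/
def SurfStep {G : GateSet.{u}} (e : Program G) (m : MDist (Program G)) : Prop :=
  ∃ (p : RawProgram G) (d : Multiset (ℝ × RawProgram G)),
    p.toProgram = e ∧
    CtxStep p.toConfig (d.map fun x => (x.1, x.2.toConfig)) ∧
    m.val = d.map fun x => (x.1, x.2.toProgram)

/-- Surface normal forms: programs without a surface step. -/
def IsSnf {G : GateSet.{u}} (e : Program G) : Prop := ∀ m, ¬ SurfStep e m

/-- The strict lifting on a multidistribution `[e]` with one program, of weight `1`: a surface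
step is performed unless `e` is in surface normal form. -/
inductive StrictOne {G : GateSet.{u}} (e : Program G) : Multiset (ℝ × Program G) → Prop
  | stay (h : IsSnf e) : StrictOne e {(1, e)}
  | step (m : MDist (Program G)) (h : SurfStep e m) : StrictOne e m.val

/-- Strict surface reduction: from `[pᵢ eᵢ | i ∈ I]` to `∑ i, pᵢ · mᵢ`, where `[eᵢ]` reduces
strictly to `mᵢ` for each `i ∈ I`. -/
def StrictRed {G : GateSet.{u}} (m n : MDist (Program G)) : Prop :=
  ∃ (k : ℕ) (p : Fin k → ℝ) (e : Fin k → Program G) (d : Fin k → Multiset (ℝ × Program G)),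
    (∀ i, StrictOne (e i) (d i)) ∧
    m.val = Finset.univ.val.map (fun i => (p i, e i)) ∧
    n.val = ∑ i, scale (p i) (d i)

/-! ### Probabilistic termination -/

open Classical in
/-- The probability that a multidistribution is in surface normal form. -/
def probSnf {G : GateSet.{u}} (m : MDist (Program G)) : ℝ :=
  (m.val.map fun x => if IsSnf x.2 then x.1 else 0).sum

/-- `s` is a sequence of strict surface reduction steps from `m`. -/
def IsStrictSeqFrom {G : GateSet.{u}} (m : MDist (Program G)) (s : ℕ → MDist (Program G)) : Prop :=
  s 0 = m ∧ ∀ k, StrictRed (s k) (s (k + 1))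

/-- The sequence `s` converges with probability `q`: the probabilities of being in surface normal
form have supremum and limit `q`. -/
def ConvergesWith {G : GateSet.{u}} (s : ℕ → MDist (Program G)) (q : ℝ) : Prop :=
  IsLUB (Set.range fun k => probSnf (s k)) q ∧
    Filter.Tendsto (fun k => probSnf (s k)) Filter.atTop (nhds q)

end QLam

end

noncomputable section
namespace QLam
namespace Term

variable {G : GateSet.{u}}

/-! ### Algebra of renamings and substitutions -/

/-! Let the value at `k` of a program be the probability of having reached a surface normal form
after `k` steps of some fixed strategy. The core of the proof is that this number does not depend on
the strategy. Hence a strict step from `m` to `n` satisfies `expValue k n = expValue (k + 1) m`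
(`StrictRed.expValue`). Iterating gives `probSnf (s k) = expValue k m` for every strict sequence `s`
from `m`, and the right-hand side mentions only `m`. It is monotone in `k` and bounded by 1, so all
sequences share the same limit and supremum.

Strategy independence rests on a diamond property (`SurfRed.diamond`). Two surface steps from a
valid term either coincide up to the name of a created register, or commute in one step each while
acting on disjoint registers. Linearity is what makes this work: a surface redex is never duplicated
or erased by another surface step, except that the same measurement or redex may be contracted by
both. Disjointness makes the corresponding operators on the memory commute (`State.act_comm`).

To avoid renumbering qubits at each step, the diamond is proved for named registers. A memory is an
unnormalized state on infinitely many qubits, the idle ones being `|0⟩`. Creating a register then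
leaves the state unchanged, a measurement resets its qubit, and outcome probabilities are absorbed
into squared norms. Every operation has two outcomes, the second being the zero operator unless it
is a measurement. Invariance under renaming and strategy independence are proved by a joint
induction (`value_perm_and_step`).

The transfer to programs has two halves. Each surface step of a program is a named step with the
same weights (`CtxStep.sum_value`). Conversely, a reducible term yields a surface step after
re-indexing (`RawProgram.exists_surfStep`), so that surface normal forms are exactly the programs
with irreducible terms. -/

theorem upSubst_var : upSubst (var : ℕ → Term G) = var := by
  funext k; cases k <;> rfl

theorem subst_var (M : Term G) : subst var M = M := by
  induction M <;> simp_all [subst, upSubst_var]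

theorem rename_eq_subst (ξ : ℕ → ℕ) (M : Term G) : rename ξ M = subst (fun k => var (ξ k)) M := by
  have up : ∀ ξ : ℕ → ℕ,
      (fun k => var (upRen ξ k) : ℕ → Term G) = upSubst fun k => var (ξ k) := by
    intro ξ; funext k; cases k <;> rfl
  induction M generalizing ξ <;> simp_all [subst, rename]

theorem subst_rename (τ : ℕ → Term G) (ξ : ℕ → ℕ) (M : Term G) :
    subst τ (rename ξ M) = subst (fun k => τ (ξ k)) M := by
  have up : ∀ (τ : ℕ → Term G) (ξ : ℕ → ℕ),
      (fun k => upSubst τ (upRen ξ k)) = upSubst fun k => τ (ξ k) := by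
    intro τ ξ; funext k; cases k <;> rfl
  induction M generalizing ξ τ <;> simp_all [subst, rename]

theorem rename_rename (ξ ζ : ℕ → ℕ) (M : Term G) :
    rename ζ (rename ξ M) = rename (fun k => ζ (ξ k)) M := by
  rw [rename_eq_subst ζ, subst_rename, ← rename_eq_subst]

theorem rename_subst (ξ : ℕ → ℕ) (τ : ℕ → Term G) (M : Term G) :
    rename ξ (subst τ M) = subst (fun k => rename ξ (τ k)) M := by
  have up : ∀ (ξ : ℕ → ℕ) (τ : ℕ → Term G),
      (fun k => rename (upRen ξ) (upSubst τ k)) = upSubst fun k => rename ξ (τ k) := by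
    intro ξ τ; funext k
    cases k
    · rfl
    · simp only [upSubst, rename_rename]; rfl
  induction M generalizing ξ τ <;> simp_all [subst, rename]

theorem subst_subst (τ θ : ℕ → Term G) (M : Term G) :
    subst θ (subst τ M) = subst (fun k => subst θ (τ k)) M := by
  have up : ∀ τ θ : ℕ → Term G,
      (fun k => subst (upSubst θ) (upSubst τ k)) = upSubst fun k => subst θ (τ k) := by
    intro τ θ; funext k
    cases k
    · rfl
    · simp only [upSubst, subst_rename, rename_subst]
  induction M generalizing τ θ <;> simp_all [subst]

/-- The substitution of `N` for the variable with index `0`. -/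
def instFun (N : Term G) : ℕ → Term G
  | 0 => N
  | k + 1 => var k

theorem inst_eq (M N : Term G) : inst M N = subst (instFun N) M := by
  unfold inst
  congr 1

theorem subst_inst (τ : ℕ → Term G) (M N : Term G) :
    subst τ (inst M N) = inst (subst (upSubst τ) M) (subst τ N) := by
  rw [inst_eq, inst_eq, subst_subst, subst_subst]
  congr 1
  funext k
  cases k with
  | zero => rfl
  | succ k =>
    simp only [instFun, subst, upSubst, subst_rename]
    exact (subst_var _).symm

theorem mapReg_rename (f : ℕ → ℕ) (ξ : ℕ → ℕ) (M : Term G) :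
    mapReg f (rename ξ M) = rename ξ (mapReg f M) := by
  induction M generalizing ξ <;> simp_all [rename, mapReg]

theorem mapReg_subst (f : ℕ → ℕ) (τ : ℕ → Term G) (M : Term G) :
    mapReg f (subst τ M) = subst (fun k => mapReg f (τ k)) (mapReg f M) := by
  have up : ∀ τ : ℕ → Term G,
      (fun k => mapReg f (upSubst τ k)) = upSubst fun k => mapReg f (τ k) := by
    intro τ; funext k
    cases k
    · rfl
    · simp only [upSubst, mapReg_rename]
  induction M generalizing τ <;> simp_all [subst, mapReg]

theorem mapReg_inst (f : ℕ → ℕ) (M N : Term G) :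
    mapReg f (inst M N) = inst (mapReg f M) (mapReg f N) := by
  rw [inst_eq, inst_eq, mapReg_subst]
  congr 1
  funext k; cases k <;> rfl

theorem mapReg_eq_self (f : ℕ → ℕ) (M : Term G) (h : ∀ i, regCount i M ≠ 0 → f i = i) :
    mapReg f M = M := by
  induction M <;> simp_all [mapReg, regCount]

/-! ### Weighted counts -/

/-- Extension of a weight function by the weight `0` for a bound variable. -/
def upW (w : ℕ → ℕ) : ℕ → ℕ
  | 0 => 0
  | k + 1 => w k

/-- Weighted number of occurrences of variables and registers, where non-surface occurrences
are multiplied by powers of `s`. -/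
def gcnt (s : ℕ) : (ℕ → ℕ) → (ℕ → ℕ) → Term G → ℕ
  | w, _, var k => w k
  | w, r, bang M => s * gcnt s w r M
  | w, r, lam M => gcnt s (upW w) r M
  | w, r, blam M => gcnt s (upW w) r M
  | w, r, app M N => gcnt s w r M + gcnt s w r N
  | _, r, reg i => r i
  | _, _, gate1 _ => 0
  | _, _, gate2 _ => 0
  | _, _, new => 0
  | w, r, meas P M N => gcnt s w r P + s * (gcnt s w r M + gcnt s w r N)

/-- The weight function of a single index. -/
def delta (k : ℕ) : ℕ → ℕ := fun j => if j = k then 1 else 0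

theorem upW_delta (k : ℕ) : upW (delta k) = delta (k + 1) := by
  funext j; cases j <;> simp [upW, delta]

theorem upW_zero : upW 0 = 0 := by
  funext j; cases j <;> rfl

/-- With `s = 1` all occurrences are counted, with `s = 0` only the surface ones. The four counts in
the definition of validity are thus instances of one function, and a single substitution formula
serves them all. -/
theorem varCount_eq (k : ℕ) (M : Term G) : varCount k M = gcnt 1 (delta k) 0 M := by
  induction M generalizing k <;> simp_all [varCount, gcnt, upW_delta, delta, add_assoc]

theorem surfVarCount_eq (k : ℕ) (M : Term G) : surfVarCount k M = gcnt 0 (delta k) 0 M := by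
  induction M generalizing k <;> simp_all [surfVarCount, gcnt, upW_delta, delta]

theorem regCount_eq (i : ℕ) (M : Term G) : regCount i M = gcnt 1 0 (delta i) M := by
  induction M <;> simp_all [regCount, gcnt, upW_zero, delta, add_assoc]

theorem surfRegCount_eq (i : ℕ) (M : Term G) : surfRegCount i M = gcnt 0 0 (delta i) M := by
  induction M <;> simp_all [surfRegCount, gcnt, upW_zero, delta]

theorem gcnt_rename (s : ℕ) (w r : ℕ → ℕ) (ξ : ℕ → ℕ) (M : Term G) :
    gcnt s w r (rename ξ M) = gcnt s (fun k => w (ξ k)) r M := by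
  have up : ∀ w ξ : ℕ → ℕ, (fun k => upW w (upRen ξ k)) = upW fun k => w (ξ k) := by
    intro w ξ; funext k; cases k <;> rfl
  induction M generalizing w ξ <;> simp_all [gcnt, rename]

theorem gcnt_subst (s : ℕ) (w r : ℕ → ℕ) (τ : ℕ → Term G) (M : Term G) :
    gcnt s w r (subst τ M) = gcnt s (fun k => gcnt s w r (τ k)) r M := by
  have up : ∀ (w : ℕ → ℕ) (τ : ℕ → Term G),
      (fun k => gcnt s (upW w) r (upSubst τ k)) = upW fun k => gcnt s w r (τ k) := by
    intro w τ; funext k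
    cases k
    · rfl
    · simp only [upSubst, gcnt_rename]; rfl
  induction M generalizing w τ <;> simp_all [gcnt, subst]

/-- Counting is linear in the weights; the register weights `r` go into one summand only, so that
they are not counted twice. -/
theorem gcnt_add_mul (s a : ℕ) (w w' r : ℕ → ℕ) (M : Term G) :
    gcnt s (fun k => w k + a * w' k) r M = gcnt s w r M + a * gcnt s w' 0 M := by
  have up : ∀ w w' : ℕ → ℕ,
      upW (fun k => w k + a * w' k) = fun k => upW w k + a * upW w' k := by
    intro w w'; funext k; cases k <;> simp [upW]
  induction M generalizing w w' <;> simp_all [gcnt] <;> ring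

theorem gcnt_zero_zero (s : ℕ) (M : Term G) : gcnt s 0 0 M = 0 := by
  induction M <;> simp_all [gcnt, upW_zero]

theorem gcnt_inst (s : ℕ) (w r : ℕ → ℕ) (M N : Term G) :
    gcnt s w r (inst M N) = gcnt s (upW w) r M + gcnt s w r N * gcnt s (delta 0) 0 M := by
  rw [inst_eq, gcnt_subst, ← gcnt_add_mul]
  congr 1
  funext k
  cases k <;> simp [instFun, gcnt, upW, delta]

/-- Because this holds summand by summand, equality of the two counts on a term passes to its
surface subterms and forces zero weight under `!` and in branches. -/
theorem gcnt_zero_le (w r : ℕ → ℕ) (M : Term G) : gcnt 0 w r M ≤ gcnt 1 w r M := by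
  induction M generalizing w <;> simp_all [gcnt] <;> grind

/-! ### Stability of linear abstractions -/

theorem linearAbs_lam (M : Term G) :
    LinearAbs (lam M) ↔
      (gcnt 1 (delta 0) 0 M = 1 ∧ gcnt 0 (delta 0) 0 M = 1) ∧ LinearAbs M := by
  rw [LinearAbs, varCount_eq, surfVarCount_eq]

theorem LinearAbs.rename {M : Term G} (h : LinearAbs M) (ξ : ℕ → ℕ) :
    LinearAbs (M.rename ξ) := by
  induction M generalizing ξ with
  | lam M ih =>
    rw [linearAbs_lam] at h
    rw [Term.rename, linearAbs_lam]
    have : (fun k => delta 0 (upRen ξ k)) = delta 0 := by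
      funext k; cases k <;> simp [delta, upRen]
    exact ⟨by simpa only [gcnt_rename, this] using h.1, ih h.2 _⟩
  | _ => simp_all [LinearAbs, Term.rename]

theorem LinearAbs.subst {M : Term G} (h : LinearAbs M) {τ : ℕ → Term G}
    (hτ : ∀ k, LinearAbs (τ k)) : LinearAbs (M.subst τ) := by
  have up : ∀ τ : ℕ → Term G, (∀ k, LinearAbs (τ k)) → ∀ k, LinearAbs (upSubst τ k) := by
    intro τ hτ k
    cases k
    · trivial
    · exact (hτ _).rename _
  induction M generalizing τ with
  | lam M ih =>
    rw [linearAbs_lam] at h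
    rw [Term.subst, linearAbs_lam]
    -- A lifted substitution brings in no new occurrence of the bound variable, since the
    -- substituted terms are shifted past index 0.
    have key : ∀ s, (fun k => gcnt s (delta 0) 0 (upSubst τ k)) = delta 0 := by
      intro s; funext k
      cases k
      · rfl
      · rw [upSubst, gcnt_rename]
        exact gcnt_zero_zero s _
    exact ⟨by simpa only [gcnt_subst, key] using h.1, ih h.2 (up _ hτ)⟩
  | blam M ih => exact ih h (up _ hτ)
  | var k => exact hτ k
  | bang M ih => exact ih h hτ
  | app M N ih ih' => exact ⟨ih h.1 hτ, ih' h.2 hτ⟩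
  | meas P M N ih ih' ih'' => exact ⟨ih h.1 hτ, ih' h.2.1 hτ, ih'' h.2.2 hτ⟩
  | _ => trivial

theorem LinearAbs.inst {M N : Term G} (h : LinearAbs M) (h' : LinearAbs N) :
    LinearAbs (M.inst N) := by
  rw [inst_eq]
  refine h.subst fun k => ?_
  cases k
  · exact h'
  · trivial

end Term

/-! ### Surface reduction of terms -/

/-- The effect on the memory of a surface step. -/
inductive Op (G : GateSet.{u}) : Type u
  | silent
  | new (i : ℕ)
  | gate1 (A : G.Unary) (i : ℕ)
  | gate2 (A : G.Binary) (i j : ℕ)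
  | meas (i : ℕ)

namespace Op

variable {G : GateSet.{u}}

/-- Renaming of the registers of an operation. -/
def mapReg (f : ℕ → ℕ) : Op G → Op G
  | silent => silent
  | new i => new (f i)
  | gate1 A i => gate1 A (f i)
  | gate2 A i j => gate2 A (f i) (f j)
  | meas i => meas (f i)

/-- The registers on which an operation acts. -/
def reads : Op G → Finset ℕ
  | silent => ∅
  | new _ => ∅
  | gate1 _ i => {i}
  | gate2 _ i j => {i, j}
  | meas i => {i}

/-- The weight of the register that is created. -/
def created (r : ℕ → ℕ) : Op G → ℕ
  | new i => r i
  | _ => 0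

/-- The weight of the register that is consumed. -/
def consumed (r : ℕ → ℕ) : Op G → ℕ
  | meas i => r i
  | _ => 0

/-- If the operation creates a register, then this register does not occur in the term. -/
def Fresh (o : Op G) (M : Term G) : Prop := ∀ i, o = new i → M.regCount i = 0

end Op

open Term

/-- `SurfRed o M M₀ M₁`: the term `M` has a surface step with the effect `o`, and `M₀`, `M₁` are
the results for the two outcomes of a measurement; other steps have two equal results. -/
inductive SurfRed {G : GateSet.{u}} : Op G → Term G → Term G → Term G → Prop
  | beta (M N : Term G) : SurfRed .silent (app (lam M) N) (M.inst N) (M.inst N)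
  | bbeta (M N : Term G) : SurfRed .silent (app (blam M) (bang N)) (M.inst N) (M.inst N)
  | new (i : ℕ) : SurfRed (.new i) new (reg i) (reg i)
  | gate1 (A : G.Unary) (i : ℕ) : SurfRed (.gate1 A i) (app (gate1 A) (reg i)) (reg i) (reg i)
  | gate2 (A : G.Binary) (i j : ℕ) :
      SurfRed (.gate2 A i j) (app (gate2 A) (lam (app (app (var 0) (reg i)) (reg j))))
        (lam (app (app (var 0) (reg i)) (reg j))) (lam (app (app (var 0) (reg i)) (reg j)))
  | meas (i : ℕ) (M N : Term G) : SurfRed (.meas i) (meas (reg i) M N) M N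
  | appL {o : Op G} {M M₀ M₁ : Term G} (N : Term G) (h : SurfRed o M M₀ M₁) :
      SurfRed o (app M N) (app M₀ N) (app M₁ N)
  | appR {o : Op G} {N N₀ N₁ : Term G} (M : Term G) (h : SurfRed o N N₀ N₁) :
      SurfRed o (app M N) (app M N₀) (app M N₁)
  | lam {o : Op G} {M M₀ M₁ : Term G} (h : SurfRed o M M₀ M₁) :
      SurfRed o (lam M) (lam M₀) (lam M₁)
  | blam {o : Op G} {M M₀ M₁ : Term G} (h : SurfRed o M M₀ M₁) :
      SurfRed o (blam M) (blam M₀) (blam M₁)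
  | measP {o : Op G} {P P₀ P₁ : Term G} (M N : Term G) (h : SurfRed o P P₀ P₁) :
      SurfRed o (meas P M N) (meas P₀ M N) (meas P₁ M N)

namespace SurfRed

variable {G : GateSet.{u}} {o o' : Op G} {M M₀ M₁ M₀' M₁' N N₀ N₁ : Term G}

theorem mapReg (h : SurfRed o M M₀ M₁) (f : ℕ → ℕ) :
    SurfRed (o.mapReg f) (M.mapReg f) (M₀.mapReg f) (M₁.mapReg f) := by
  induction h <;> simp only [mapReg_inst, Term.mapReg, Op.mapReg] <;> constructor <;> assumption

theorem subst (h : SurfRed o M M₀ M₁) (τ : ℕ → Term G) :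
    SurfRed o (M.subst τ) (M₀.subst τ) (M₁.subst τ) := by
  induction h generalizing τ with
  | beta M N => rw [subst_inst]; exact beta _ _
  | bbeta M N => rw [subst_inst]; exact bbeta _ _
  | new i => exact new i
  | gate1 A i => exact gate1 A i
  | gate2 A i j => exact gate2 A i j
  | meas i M N => exact meas i _ _
  | appL N _ ih => exact appL _ (ih τ)
  | appR M _ ih => exact appR _ (ih τ)
  | lam _ ih => exact lam (ih _)
  | blam _ ih => exact blam (ih _)
  | measP M N _ ih => exact measP _ _ (ih τ)

theorem inst_left (h : SurfRed o M M₀ M₁) (N : Term G) :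
    SurfRed o (M.inst N) (M₀.inst N) (M₁.inst N) := by
  simpa only [inst_eq] using h.subst (instFun N)

theorem rename (h : SurfRed o M M₀ M₁) (ξ : ℕ → ℕ) :
    SurfRed o (M.rename ξ) (M₀.rename ξ) (M₁.rename ξ) := by
  simpa only [rename_eq_subst] using h.subst _

theorem subst_congr (M : Term G) (k : ℕ) (τ θ : ℕ → Term G) (h : ∀ j, j ≠ k → τ j = θ j)
    (hM : gcnt 1 (delta k) 0 M = 0) : M.subst τ = M.subst θ := by
  have up : ∀ (k : ℕ) (τ θ : ℕ → Term G), (∀ j, j ≠ k → τ j = θ j) →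
      ∀ j, j ≠ k + 1 → upSubst τ j = upSubst θ j := by
    intro k τ θ h j hj
    cases j with
    | zero => rfl
    | succ j => simp only [upSubst]; rw [h j (by omega)]
  induction M generalizing k τ θ with
  | var j =>
    refine h j ?_
    rintro rfl
    simp [gcnt, delta] at hM
  | bang M ih => simp [gcnt] at hM; simp [Term.subst, ih k τ θ h hM]
  | lam M ih =>
    rw [gcnt, upW_delta] at hM; simp [Term.subst, ih (k + 1) _ _ (up k τ θ h) hM]
  | blam M ih =>
    rw [gcnt, upW_delta] at hM; simp [Term.subst, ih (k + 1) _ _ (up k τ θ h) hM]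
  | app M N ih ih' =>
    simp [gcnt] at hM; simp [Term.subst, ih k τ θ h hM.1, ih' k τ θ h hM.2]
  | meas P M N ih ih' ih'' =>
    simp [gcnt] at hM
    simp [Term.subst, ih k τ θ h hM.1, ih' k τ θ h hM.2.1, ih'' k τ θ h hM.2.2]
  | _ => rfl

/-- A surface step in a term substituted for a variable with exactly one occurrence, which is
surface. -/
theorem subst_right (M : Term G) (k : ℕ) (τ τ₀ τ₁ : ℕ → Term G)
    (h : ∀ j, j ≠ k → τ₀ j = τ j ∧ τ₁ j = τ j) (hk : SurfRed o (τ k) (τ₀ k) (τ₁ k))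
    (hM : gcnt 1 (delta k) 0 M = 1) (hM' : gcnt 0 (delta k) 0 M = 1) :
    SurfRed o (M.subst τ) (M.subst τ₀) (M.subst τ₁) := by
  have up : ∀ (k : ℕ) (τ θ : ℕ → Term G), (∀ j, j ≠ k → τ j = θ j) →
      ∀ j, j ≠ k + 1 → upSubst τ j = upSubst θ j := by
    intro k τ θ h j hj
    cases j with
    | zero => rfl
    | succ j => simp only [upSubst]; rw [h j (by omega)]
  induction M generalizing k τ τ₀ τ₁ with
  | var j =>
    have : j = k := by
      by_contra hj
      simp [gcnt, delta, hj] at hM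
    subst this
    exact hk
  | bang M ih => simp [gcnt] at hM'
  | lam M ih =>
    rw [gcnt, upW_delta] at hM hM'
    exact lam (ih (k + 1) _ _ _ (fun j hj => ⟨up k _ _ (fun j hj => (h j hj).1) j hj,
      up k _ _ (fun j hj => (h j hj).2) j hj⟩) (hk.rename _) hM hM')
  | blam M ih =>
    rw [gcnt, upW_delta] at hM hM'
    exact blam (ih (k + 1) _ _ _ (fun j hj => ⟨up k _ _ (fun j hj => (h j hj).1) j hj,
      up k _ _ (fun j hj => (h j hj).2) j hj⟩) (hk.rename _) hM hM')
  | app M N ih ih' =>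
    have e := gcnt_zero_le (delta k) 0 M
    have e' := gcnt_zero_le (delta k) 0 N
    simp only [gcnt] at hM hM'
    -- The unique occurrence lies on one side of the application; by `subst_congr` the other side is
    -- the same for all three substitutions.
    rcases Nat.eq_zero_or_pos (gcnt 1 (delta k) 0 M) with h0 | h0
    · have c₀ := subst_congr M k τ₀ τ (fun j hj => (h j hj).1) h0
      have c₁ := subst_congr M k τ₁ τ (fun j hj => (h j hj).2) h0
      simp only [Term.subst, c₀, c₁]
      exact appR _ (ih' k _ _ _ h hk (by omega) (by omega))
    · have c₀ := subst_congr N k τ₀ τ (fun j hj => (h j hj).1) (by omega)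
      have c₁ := subst_congr N k τ₁ τ (fun j hj => (h j hj).2) (by omega)
      simp only [Term.subst, c₀, c₁]
      exact appL _ (ih k _ _ _ h hk (by omega) (by omega))
  | meas P M N ih ih' ih'' =>
    have e := gcnt_zero_le (delta k) 0 P
    simp only [gcnt] at hM hM'
    have c₀ := subst_congr M k τ₀ τ (fun j hj => (h j hj).1) (by omega)
    have c₁ := subst_congr M k τ₁ τ (fun j hj => (h j hj).2) (by omega)
    have d₀ := subst_congr N k τ₀ τ (fun j hj => (h j hj).1) (by omega)
    have d₁ := subst_congr N k τ₁ τ (fun j hj => (h j hj).2) (by omega)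
    simp only [Term.subst, c₀, c₁, d₀, d₁]
    exact measP _ _ (ih k _ _ _ h hk (by omega) (by omega))
  | _ => simp [gcnt] at hM

theorem inst_right (M : Term G) (hM : LinearAbs (Term.lam M)) (h : SurfRed o N N₀ N₁) :
    SurfRed o (M.inst N) (M.inst N₀) (M.inst N₁) := by
  rw [linearAbs_lam] at hM
  simp only [inst_eq]
  refine subst_right M 0 _ _ _ (fun j hj => ?_) h hM.1.1 hM.1.2
  cases j
  · exact absurd rfl hj
  · exact ⟨rfl, rfl⟩

/-! ### Preservation of validity -/

/-- A conservation law: if all weight sits at surface positions, a step changes it only through the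
created or consumed register. A linear `β` step moves its argument to exactly one surface place. In
the other `β` step the argument is under `!`, so it has weight zero and copying it is harmless;
likewise for the discarded branch of a measurement. -/
theorem gcnt_result (h : SurfRed o M M₀ M₁) (hM : LinearAbs M) (w r : ℕ → ℕ)
    (hs : gcnt 1 w r M = gcnt 0 w r M) :
    ∀ s, s = 0 ∨ s = 1 →
      gcnt s w r M₀ + o.consumed r = gcnt s w r M + o.created r ∧
      gcnt s w r M₁ + o.consumed r = gcnt s w r M + o.created r := by
  induction h generalizing w with
  | beta M N =>
    have hM' := (linearAbs_lam M).1 hM.1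
    rintro s (rfl | rfl) <;> simp [gcnt_inst, gcnt, hM', Op.consumed, Op.created]
  | bbeta M N =>
    have e := gcnt_zero_le (upW w) r M
    have e' := gcnt_zero_le w r N
    simp only [gcnt] at hs
    have h1 : gcnt 1 w r N = 0 := by omega
    have h0 : gcnt 0 w r N = 0 := by omega
    rintro s (rfl | rfl) <;> simp [gcnt_inst, gcnt, h1, h0, Op.consumed, Op.created]
  | new i => simp [gcnt, Op.consumed, Op.created]
  | gate1 A i => simp [gcnt, Op.consumed, Op.created]
  | gate2 A i j => simp [gcnt, Op.consumed, Op.created]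
  | meas i M N =>
    have e := gcnt_zero_le w r M
    have e' := gcnt_zero_le w r N
    simp only [gcnt] at hs
    rintro s (rfl | rfl) <;> simp only [gcnt, Op.consumed, Op.created] <;> omega
  | @appL _ M _ _ N _ ih =>
    have e := gcnt_zero_le w r M
    have e' := gcnt_zero_le w r N
    simp only [gcnt] at hs
    have := ih hM.1 w (by omega)
    intro s hs'
    have := this s hs'
    simp only [gcnt]
    omega
  | @appR _ N _ _ M _ ih =>
    have e := gcnt_zero_le w r M
    have e' := gcnt_zero_le w r N
    simp only [gcnt] at hs
    have := ih hM.2 w (by omega)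
    intro s hs'
    have := this s hs'
    simp only [gcnt]
    omega
  | lam _ ih => exact ih hM.2 _ hs
  | blam _ ih => exact ih hM _ hs
  | @measP _ P _ _ M N _ ih =>
    have e := gcnt_zero_le w r P
    simp only [gcnt] at hs
    have := ih hM.1 w (by omega)
    intro s hs'
    have := this s hs'
    simp only [gcnt]
    omega

theorem linearAbs (h : SurfRed o M M₀ M₁) (hM : LinearAbs M) : LinearAbs M₀ ∧ LinearAbs M₁ := by
  have hc : ∀ o : Op G, o.consumed 0 = 0 ∧ o.created 0 = 0 := by
    intro o; cases o <;> exact ⟨rfl, rfl⟩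
  induction h with
  | beta M N => exact ⟨hM.1.2.inst hM.2, hM.1.2.inst hM.2⟩
  | bbeta M N => exact ⟨LinearAbs.inst hM.1 hM.2, LinearAbs.inst hM.1 hM.2⟩
  | new i => exact ⟨trivial, trivial⟩
  | gate1 A i => exact ⟨trivial, trivial⟩
  | gate2 A i j => exact ⟨hM.2, hM.2⟩
  | meas i M N => exact hM.2
  | appL N _ ih => exact ⟨⟨(ih hM.1).1, hM.2⟩, ⟨(ih hM.1).2, hM.2⟩⟩
  | appR M _ ih => exact ⟨⟨hM.1, (ih hM.2).1⟩, ⟨hM.1, (ih hM.2).2⟩⟩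
  | @lam o _ _ _ h ih =>
    rw [linearAbs_lam] at hM
    have hc := hc o
    -- With weight 1 on the bound variable and 0 on registers, the conservation law says that this
    -- variable keeps its single surface occurrence.
    have g0 := h.gcnt_result hM.2 (delta 0) 0 (by omega) 0 (.inl rfl)
    have g1 := h.gcnt_result hM.2 (delta 0) 0 (by omega) 1 (.inr rfl)
    rw [linearAbs_lam, linearAbs_lam]
    refine ⟨⟨by omega, (ih hM.2).1⟩, ⟨by omega, (ih hM.2).2⟩⟩
  | blam _ ih => exact ih hM
  | measP M N _ ih => exact ⟨⟨(ih hM.1).1, hM.2⟩, ⟨(ih hM.1).2, hM.2⟩⟩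

theorem regCount_result (h : SurfRed o M M₀ M₁) (hM : M.Valid) (i : ℕ) :
    M₀.regCount i + o.consumed (delta i) = M.regCount i + o.created (delta i) ∧
    M₁.regCount i + o.consumed (delta i) = M.regCount i + o.created (delta i) := by
  have := hM.2.1 i
  simp only [regCount_eq, surfRegCount_eq] at this ⊢
  exact h.gcnt_result hM.2.2 0 (delta i) this.symm 1 (.inr rfl)

theorem valid (h : SurfRed o M M₀ M₁) (hM : M.Valid) (ho : o.Fresh M) :
    M₀.Valid ∧ M₁.Valid := by
  have key : ∀ i, o.created (delta i) = 0 ∨ M.regCount i = 0 ∧ o.created (delta i) ≤ 1 := by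
    intro i
    cases o with
    | new j =>
      by_cases hij : j = i
      · subst hij
        exact .inr ⟨ho j rfl, by simp [Op.created, delta]⟩
      · exact .inl (by simp [Op.created, delta, hij])
    | _ => exact .inl rfl
  have surf : ∀ i, (M₀.surfRegCount i = M₀.regCount i) ∧ M₁.surfRegCount i = M₁.regCount i := by
    intro i
    have := hM.2.1 i
    simp only [regCount_eq, surfRegCount_eq] at this ⊢
    have g0 := h.gcnt_result hM.2.2 0 (delta i) this.symm 0 (.inl rfl)
    have g1 := h.gcnt_result hM.2.2 0 (delta i) this.symm 1 (.inr rfl)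
    omega
  have l := h.linearAbs hM.2.2
  refine ⟨⟨fun i => ?_, fun i => (surf i).1, l.1⟩, ⟨fun i => ?_, fun i => (surf i).2, l.2⟩⟩ <;>
  · have := h.regCount_result hM i
    have := key i
    have := hM.1 i
    omega

theorem regCount_pos (h : SurfRed o M M₀ M₁) {i : ℕ} (hi : i ∈ o.reads) : 1 ≤ M.regCount i := by
  induction h with
  | gate2 A i j =>
    simp only [Op.reads, Finset.mem_insert, Finset.mem_singleton] at hi
    rcases hi with rfl | rfl <;> simp [regCount]
  | meas => simp_all [regCount, Op.reads, add_assoc]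
  | beta | bbeta | new | gate1 => simp_all [regCount, Op.reads]
  | _ => rename_i ih; have := ih hi; simp only [regCount]; omega

/-! ### The diamond property -/

/-- The two steps from a term commute, and act on different registers. -/
def Commute (o o' : Op G) (M₀ M₁ M₀' M₁' : Term G) : Prop :=
  Disjoint o.reads o'.reads ∧ ∃ N₀₀ N₀₁ N₁₀ N₁₁, SurfRed o' M₀ N₀₀ N₀₁ ∧ SurfRed o' M₁ N₁₀ N₁₁ ∧
    SurfRed o M₀' N₀₀ N₁₀ ∧ SurfRed o M₁' N₀₁ N₁₁

/-- The two steps from a term are equal up to the name of a new register. -/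
def Same (o o' : Op G) (M₀ M₁ M₀' M₁' : Term G) : Prop :=
  (o = o' ∧ M₀ = M₀' ∧ M₁ = M₁') ∨ ∃ i j, o = .new i ∧ o' = .new j ∧
    M₀.mapReg (Equiv.swap i j) = M₀' ∧ M₁.mapReg (Equiv.swap i j) = M₁'

theorem Commute.symm (h : Commute o o' M₀ M₁ M₀' M₁') : Commute o' o M₀' M₁' M₀ M₁ := by
  obtain ⟨hd, N₀₀, N₀₁, N₁₀, N₁₁, h₁, h₂, h₃, h₄⟩ := h
  exact ⟨hd.symm, N₀₀, N₁₀, N₀₁, N₁₁, h₃, h₄, h₁, h₂⟩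

theorem Commute.map (h : Commute o o' M₀ M₁ M₀' M₁') (F : Term G → Term G)
    (hF : ∀ o M M₀ M₁, SurfRed o M M₀ M₁ → SurfRed o (F M) (F M₀) (F M₁)) :
    Commute o o' (F M₀) (F M₁) (F M₀') (F M₁') := by
  obtain ⟨hd, N₀₀, N₀₁, N₁₀, N₁₁, h₁, h₂, h₃, h₄⟩ := h
  exact ⟨hd, F N₀₀, F N₀₁, F N₁₀, F N₁₁, hF _ _ _ _ h₁, hF _ _ _ _ h₂, hF _ _ _ _ h₃,
    hF _ _ _ _ h₄⟩

theorem Same.map (h : Same o o' M₀ M₁ M₀' M₁') (F : Term G → Term G)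
    (hF : ∀ i j, o = .new i → o' = .new j → ∀ M,
      (F M).mapReg (Equiv.swap i j) = F (M.mapReg (Equiv.swap i j))) :
    Same o o' (F M₀) (F M₁) (F M₀') (F M₁') := by
  obtain ⟨rfl, rfl, rfl⟩ | ⟨i, j, rfl, rfl, rfl, rfl⟩ := h
  · exact .inl ⟨rfl, rfl, rfl⟩
  · exact .inr ⟨i, j, rfl, rfl, hF i j rfl rfl _, hF i j rfl rfl _⟩

theorem mapReg_swap_of_fresh {i j : ℕ} (hi : M.regCount i = 0) (hj : M.regCount j = 0) :
    M.mapReg (Equiv.swap i j) = M := by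
  refine mapReg_eq_self _ _ fun k hk => Equiv.swap_apply_of_ne_of_ne ?_ ?_ <;>
  · rintro rfl; contradiction

/-- A step in the body is stable under substitution; a step in the argument survives as one surface
step because the linear variable has one occurrence, at the surface. -/
theorem commute_beta {M : Term G} {L L₀ L₁ N : Term G} (hM : LinearAbs (app (Term.lam M) N))
    (hL : L = app (Term.lam M) N) (h : SurfRed o L L₀ L₁) :
    Same .silent o (M.inst N) (M.inst N) L₀ L₁ ∨ Commute .silent o (M.inst N) (M.inst N) L₀ L₁ := by
  cases h with
  | appL N h =>
    cases hL
    cases h with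
    | lam h =>
      exact .inr ⟨Finset.disjoint_empty_left _, _, _, _, _, h.inst_left N, h.inst_left N,
        beta _ _, beta _ _⟩
  | appR M h =>
    cases hL
    exact .inr ⟨Finset.disjoint_empty_left _, _, _, _, _, h.inst_right _ hM.1,
      h.inst_right _ hM.1, beta _ _, beta _ _⟩
  | beta => cases hL; exact .inl (.inl ⟨rfl, rfl, rfl⟩)
  | _ => cases hL

/-- The argument is under `!` and has no surface step, so only steps in the body compete with the
contraction. -/
theorem commute_bbeta {M : Term G} {L L₀ L₁ N : Term G}
    (hL : L = app (Term.blam M) (bang N)) (h : SurfRed o L L₀ L₁) :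
    Same .silent o (M.inst N) (M.inst N) L₀ L₁ ∨ Commute .silent o (M.inst N) (M.inst N) L₀ L₁ := by
  cases h with
  | appL N h =>
    cases hL
    cases h with
    | blam h =>
      exact .inr ⟨Finset.disjoint_empty_left _, _, _, _, _, h.inst_left _, h.inst_left _,
        bbeta _ _, bbeta _ _⟩
  | appR M h => cases hL; cases h
  | bbeta => cases hL; exact .inl (.inl ⟨rfl, rfl, rfl⟩)
  | _ => cases hL

theorem not_pair {i j : ℕ} : ¬ SurfRed o (Term.lam (app (app (var 0) (reg i)) (reg j))) M₀ M₁ := by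
  intro h
  cases h with
  | lam h =>
    cases h with
    | appL _ h =>
      cases h with
      | appL _ h => cases h
      | appR _ h => cases h
    | appR _ h => cases h

theorem Same.symm (h : Same o o' M₀ M₁ M₀' M₁') : Same o' o M₀' M₁' M₀ M₁ := by
  obtain ⟨rfl, rfl, rfl⟩ | ⟨i, j, rfl, rfl, rfl, rfl⟩ := h
  · exact .inl ⟨rfl, rfl, rfl⟩
  · refine .inr ⟨j, i, rfl, rfl, ?_, ?_⟩ <;>
    · rw [mapReg_mapReg, Equiv.swap_comm j i]
      simp [mapReg_id]

/-- Any two surface steps from a valid term are equal up to the name of a new register, or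
commute. -/
theorem diamond (h : SurfRed o M M₀ M₁) (h' : SurfRed o' M M₀' M₁') (hl : LinearAbs M)
    (hr : ∀ i, M.regCount i ≤ 1) (hf : o.Fresh M) (hf' : o'.Fresh M) :
    Same o o' M₀ M₁ M₀' M₁' ∨ Commute o o' M₀ M₁ M₀' M₁' := by
  induction h generalizing M₀' M₁' with
  | beta M N => exact commute_beta hl rfl h'
  | bbeta M N => exact commute_bbeta rfl h'
  | new i =>
    cases h' with
    | new j => exact .inl (.inr ⟨i, j, rfl, rfl, by simp [Term.mapReg], by simp [Term.mapReg]⟩)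
  | gate1 A i =>
    cases h' with
    | gate1 A i => exact .inl (.inl ⟨rfl, rfl, rfl⟩)
    | appL _ h => cases h
    | appR _ h => cases h
  | gate2 A i j =>
    cases h' with
    | gate2 A i => exact .inl (.inl ⟨rfl, rfl, rfl⟩)
    | appL _ h => cases h
    | appR _ h => exact absurd h not_pair
  | meas i M N =>
    cases h' with
    | meas i => exact .inl (.inl ⟨rfl, rfl, rfl⟩)
    | measP _ _ h => cases h
  | @appL o M M₀ M₁ N h ih =>
    have hfM : o.Fresh M := fun i hi => by have := hf i hi; simp only [regCount] at this; omega
    have hfN : o.Fresh N := fun i hi => by have := hf i hi; simp only [regCount] at this; omega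
    have hfM' : o'.Fresh M := fun i hi => by have := hf' i hi; simp only [regCount] at this; omega
    have hfN' : o'.Fresh N := fun i hi => by have := hf' i hi; simp only [regCount] at this; omega
    cases h' with
    | beta => exact (commute_beta hl rfl (appL N h)).imp Same.symm Commute.symm
    | bbeta => exact (commute_bbeta rfl (appL _ h)).imp Same.symm Commute.symm
    | gate1 A i => cases h
    | gate2 A i j => cases h
    | appL _ h' =>
      refine (ih h' hl.1 (fun i => le_trans (by simp [regCount]) (hr i)) hfM hfM').imp
        (fun h => h.map (fun M => app M N) fun i j hi hj M => ?_)
        (fun h => h.map (fun M => app M N) fun _ _ _ _ h => appL _ h)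
      simp only [Term.mapReg]
      -- Both new names are fresh for the whole application, so exchanging them leaves the other
      -- component alone.
      rw [mapReg_swap_of_fresh (hfN i hi) (hfN' j hj)]
    -- Steps in different components: a register read by both would occur twice.
    | appR _ h' =>
      refine .inr ⟨Finset.disjoint_left.2 fun i hi hi' => ?_, _, _, _, _, appR _ h', appR _ h',
        appL _ h, appL _ h⟩
      have := h.regCount_pos hi
      have := h'.regCount_pos hi'
      have := hr i
      simp only [regCount] at this
      omega
  | @appR o N N₀ N₁ M h ih =>
    have hfM : o.Fresh M := fun i hi => by have := hf i hi; simp only [regCount] at this; omega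
    have hfN : o.Fresh N := fun i hi => by have := hf i hi; simp only [regCount] at this; omega
    have hfM' : o'.Fresh M := fun i hi => by have := hf' i hi; simp only [regCount] at this; omega
    have hfN' : o'.Fresh N := fun i hi => by have := hf' i hi; simp only [regCount] at this; omega
    cases h' with
    | beta => exact (commute_beta hl rfl (appR _ h)).imp Same.symm Commute.symm
    | bbeta => cases h
    | gate1 A i => cases h
    | gate2 A i j => exact absurd h not_pair
    | appR _ h' =>
      refine (ih h' hl.2 (fun i => le_trans (by simp [regCount]) (hr i)) hfN hfN').imp
        (fun h => h.map (fun N => app M N) fun i j hi hj N => ?_)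
        (fun h => h.map (fun N => app M N) fun _ _ _ _ h => appR _ h)
      simp only [Term.mapReg]
      rw [mapReg_swap_of_fresh (hfM i hi) (hfM' j hj)]
    | appL _ h' =>
      refine .inr ⟨Finset.disjoint_left.2 fun i hi hi' => ?_, _, _, _, _, appL _ h', appL _ h',
        appR _ h, appR _ h⟩
      have := h.regCount_pos hi
      have := h'.regCount_pos hi'
      have := hr i
      simp only [regCount] at this
      omega
  | lam h ih =>
    cases h' with
    | lam h' =>
      exact (ih h' hl.2 hr hf hf').imp
        (fun h => h.map Term.lam fun i j hi hj M => rfl)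
        (fun h => h.map Term.lam fun _ _ _ _ h => lam h)
  | blam h ih =>
    cases h' with
    | blam h' =>
      exact (ih h' hl hr hf hf').imp
        (fun h => h.map Term.blam fun i j hi hj M => rfl)
        (fun h => h.map Term.blam fun _ _ _ _ h => blam h)
  | @measP o P P₀ P₁ M N h ih =>
    have hfP : o.Fresh P := fun i hi => by have := hf i hi; simp only [regCount] at this; omega
    have hfP' : o'.Fresh P := fun i hi => by have := hf' i hi; simp only [regCount] at this; omega
    cases h' with
    | meas i => cases h
    | measP _ _ h' =>
      refine (ih h' hl.1 (fun i => le_trans (by simp [regCount, add_assoc]) (hr i)) hfP hfP').imp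
        (fun h => h.map (fun P => Term.meas P M N) fun i j hi hj P => ?_)
        (fun h => h.map (fun P => Term.meas P M N) fun _ _ _ _ h => measP _ _ h)
      have h1 := hf i hi
      have h2 := hf' j hj
      simp only [regCount] at h1 h2
      simp only [Term.mapReg]
      rw [mapReg_swap_of_fresh (M := M) (by omega) (by omega),
        mapReg_swap_of_fresh (M := N) (by omega) (by omega)]

end SurfRed

/-! ### Memories with named registers -/

/-- Unnormalized states of a memory with registers named by natural numbers, in coordinates with
respect to the basis of the sets of registers with bit `1`. -/
abbrev State : Type := Finset ℕ → ℂ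

namespace State

/-- The bit of a register. -/
def bit (i : ℕ) (s : Finset ℕ) : Fin 2 := if i ∈ s then 1 else 0

/-- The action on the registers in `R` of the matrix `k`. -/
def act (R : Finset ℕ) (k : Finset ℕ → Finset ℕ → ℂ) (Q : State) : State :=
  fun s => ∑ t ∈ R.powerset, k (s ∩ R) t * Q (s \ R ∪ t)

/-- Both sides are the same double sum over bits on `R` and on `R'`, as disjointness keeps either
update from affecting the other's bits. -/
theorem act_comm {R R' : Finset ℕ} (h : Disjoint R R') (k k' : Finset ℕ → Finset ℕ → ℂ)
    (Q : State) : act R k (act R' k' Q) = act R' k' (act R k Q) := by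
  funext s
  simp only [act, Finset.mul_sum]
  rw [Finset.sum_comm]
  refine Finset.sum_congr rfl fun t' ht' => Finset.sum_congr rfl fun t ht => ?_
  rw [Finset.mem_powerset] at ht ht'
  have e : (s \ R ∪ t) ∩ R' = s ∩ R' := by
    ext x
    have := @Finset.disjoint_left _ R R'
    grind
  have e' : (s \ R' ∪ t') ∩ R = s ∩ R := by
    ext x
    have := @Finset.disjoint_left _ R R'
    grind
  have e'' : (s \ R ∪ t) \ R' ∪ t' = (s \ R' ∪ t') \ R ∪ t := by
    ext x
    have := @Finset.disjoint_left _ R R'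
    grind
  rw [e, e', e'']
  ring

theorem act_smul (R : Finset ℕ) (k : Finset ℕ → Finset ℕ → ℂ) (z : ℂ) (Q : State) :
    act R k (z • Q) = z • act R k Q := by
  funext s
  simp only [act, Pi.smul_apply, smul_eq_mul, Finset.mul_sum]
  exact Finset.sum_congr rfl fun t _ => by ring

/-- Renaming of the registers. -/
def perm (σ : Equiv.Perm ℕ) (Q : State) : State := fun s => Q (s.map σ.symm.toEmbedding)

theorem map_map_symm (σ : Equiv.Perm ℕ) (s : Finset ℕ) :
    (s.map σ.symm.toEmbedding).map σ.toEmbedding = s := by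
  ext x; simp

theorem map_symm_map (σ : Equiv.Perm ℕ) (s : Finset ℕ) :
    (s.map σ.toEmbedding).map σ.symm.toEmbedding = s := by
  ext x; simp

theorem perm_act (σ : Equiv.Perm ℕ) (R : Finset ℕ) (k k' : Finset ℕ → Finset ℕ → ℂ)
    (hk : ∀ u t, k' (u.map σ.toEmbedding) (t.map σ.toEmbedding) = k u t) (Q : State) :
    act (R.map σ.toEmbedding) k' (perm σ Q) = perm σ (act R k Q) := by
  funext s
  obtain ⟨s, rfl⟩ : ∃ s₀ : Finset ℕ, s₀.map σ.toEmbedding = s := ⟨_, map_map_symm σ s⟩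
  simp only [act, perm, map_symm_map]
  symm
  refine Finset.sum_nbij' (fun t => t.map σ.toEmbedding) (fun t => t.map σ.symm.toEmbedding)
    ?_ ?_ ?_ ?_ ?_
  · intro t ht
    rw [Finset.mem_powerset] at ht ⊢
    exact Finset.map_subset_map.2 ht
  · intro t ht
    rw [Finset.mem_powerset] at ht ⊢
    rw [← map_symm_map σ R]
    exact Finset.map_subset_map.2 ht
  · intro t _; exact map_symm_map σ t
  · intro t _; exact map_map_symm σ t
  · intro t _
    rw [← Finset.map_inter, hk, Finset.map_union, map_symm_map, Finset.map_sdiff, map_symm_map,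
      map_symm_map]

/-- The register `j` is not in use, and its qubit is `|0⟩`. -/
def Unused (j : ℕ) (Q : State) : Prop := ∀ s, j ∈ s → Q s = 0

theorem Unused.act {j : ℕ} {Q : State} (h : Unused j Q) {R : Finset ℕ} (hj : j ∉ R)
    (k : Finset ℕ → Finset ℕ → ℂ) : Unused j (act R k Q) := by
  intro s hs
  refine Finset.sum_eq_zero fun t _ => ?_
  rw [h _ (by simp [hs, hj]), mul_zero]

/-- Both qubits are `|0⟩`. This is why the choice of a fresh register name does not matter. -/
theorem perm_swap {i j : ℕ} {Q : State} (hi : Unused i Q) (hj : Unused j Q) :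
    perm (Equiv.swap i j) Q = Q := by
  funext s
  simp only [perm]
  by_cases h : i ∈ s ∨ j ∈ s
  · have e : Q s = 0 := h.elim (hi s) (hj s)
    rw [e]
    rcases h with h | h
    · exact hj _ (by simpa using h)
    · exact hi _ (by simpa using h)
  · push Not at h
    congr 1
    ext x
    simp only [Finset.mem_map_equiv, Equiv.symm_symm]
    by_cases hx : x = i
    · subst hx; simp [h]
    by_cases hx' : x = j
    · subst hx'; simp [h]
    rw [Equiv.swap_apply_of_ne_of_ne hx hx']

/-- The squared norm. -/
def normSq (Q : State) : ℝ := ∑' s, ‖Q s‖ ^ 2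

theorem normSq_nonneg (Q : State) : 0 ≤ normSq Q := tsum_nonneg fun _ => by positivity

/-- No summability is needed: the default value 0 of a divergent `tsum` is compatible with scaling.
-/
theorem normSq_smul (z : ℂ) (Q : State) : normSq (z • Q) = ‖z‖ ^ 2 * normSq Q := by
  simp only [normSq, Pi.smul_apply, smul_eq_mul, norm_mul, mul_pow, tsum_mul_left]

theorem normSq_perm (σ : Equiv.Perm ℕ) (Q : State) : normSq (perm σ Q) = normSq Q :=
  (Equiv.finsetCongr σ.symm).tsum_eq fun s => ‖Q s‖ ^ 2

end State

open State

/-! ### Operations as pairs of Kraus operators -/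

namespace Op

variable {G : GateSet.{u}}

/-- The matrix by which an operation acts on its registers, for an outcome `b`. After a
measurement, the qubit is reset to `|0⟩`. -/
def kernel : Op G → Fin 2 → Finset ℕ → Finset ℕ → ℂ
  | silent, b, _, _ => if b = 0 then 1 else 0
  | new _, b, _, _ => if b = 0 then 1 else 0
  | gate1 A i, b, u, t => if b = 0 then (G.mat1 A).1 (bit i u) (bit i t) else 0
  | gate2 A i j, b, u, t =>
    if b = 0 then (G.mat2 A).1 (bit i u, bit j u) (bit i t, bit j t) else 0
  | meas i, b, u, t => if u = ∅ ∧ bit i t = b then 1 else 0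

/-- The effect of an operation on the memory, for an outcome `b`. -/
def kraus (o : Op G) (b : Fin 2) (Q : State) : State := act o.reads (o.kernel b) Q

theorem kraus_smul (o : Op G) (b : Fin 2) (z : ℂ) (Q : State) :
    o.kraus b (z • Q) = z • o.kraus b Q := act_smul _ _ _ _

theorem kraus_comm {o o' : Op G} (h : Disjoint o.reads o'.reads) (b b' : Fin 2) (Q : State) :
    o.kraus b (o'.kraus b' Q) = o'.kraus b' (o.kraus b Q) := act_comm h _ _ _

theorem reads_mapReg (o : Op G) (σ : Equiv.Perm ℕ) :
    (o.mapReg σ).reads = o.reads.map σ.toEmbedding := by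
  cases o <;> simp [reads, mapReg]

theorem kraus_mapReg (o : Op G) (b : Fin 2) (σ : Equiv.Perm ℕ) (Q : State) :
    (o.mapReg σ).kraus b (perm σ Q) = perm σ (o.kraus b Q) := by
  rw [kraus, reads_mapReg, perm_act (k := o.kernel b)]
  · rfl
  · intro u t
    cases o <;> simp [kernel, mapReg, bit]
    congr

theorem kraus_new (i : ℕ) (Q : State) : (new i : Op G).kraus 0 Q = Q := by
  funext s; simp [kraus, reads, act, kernel]

theorem kraus_silent (Q : State) : (silent : Op G).kraus 0 Q = Q := by
  funext s; simp [kraus, reads, act, kernel]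

theorem kraus_one (o : Op G) (h : ∀ i, o ≠ meas i) (Q : State) : o.kraus 1 Q = 0 := by
  funext s
  cases o <;> simp_all [kraus, act, kernel]

theorem unused_kraus_meas (i : ℕ) (b : Fin 2) (Q : State) :
    Unused i ((meas i : Op G).kraus b Q) := by
  intro s hs
  rw [kraus, act]
  refine Finset.sum_eq_zero fun t _ => ?_
  have : s ∩ {i} ≠ ∅ := by
    rw [Finset.inter_singleton_of_mem hs]
    exact Finset.singleton_ne_empty _
  simp [kernel, reads, this]

end Op

/-! ### Probabilities of termination of named programs -/

section Value

variable {G : GateSet.{u}} {o o' : Op G} {M M₀ M₁ M₀' M₁' : Term G} {Q : State}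

open Term

/-! ### Register renaming, freshness and reducibility -/

theorem Term.regCount_mapReg (σ : Equiv.Perm ℕ) (i : ℕ) (M : Term G) :
    (M.mapReg σ).regCount (σ i) = M.regCount i := by
  induction M <;> simp_all [mapReg, regCount]

theorem Term.surfRegCount_mapReg (σ : Equiv.Perm ℕ) (i : ℕ) (M : Term G) :
    (M.mapReg σ).surfRegCount (σ i) = M.surfRegCount i := by
  induction M <;> simp_all [mapReg, surfRegCount]

theorem Term.gcnt_mapReg (s : ℕ) (w r : ℕ → ℕ) (f : ℕ → ℕ) (M : Term G) :
    gcnt s w r (M.mapReg f) = gcnt s w (fun i => r (f i)) M := by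
  induction M generalizing w <;> simp_all [mapReg, gcnt]

theorem Term.LinearAbs.mapReg (h : LinearAbs M) (f : ℕ → ℕ) : LinearAbs (M.mapReg f) := by
  induction M with
  | lam M ih =>
    rw [linearAbs_lam] at h
    rw [Term.mapReg, linearAbs_lam, gcnt_mapReg, gcnt_mapReg]
    exact ⟨h.1, ih h.2⟩
  | _ => simp_all [LinearAbs, Term.mapReg]

theorem Term.Valid.mapReg (h : M.Valid) (σ : Equiv.Perm ℕ) : (M.mapReg σ).Valid := by
  refine ⟨fun i => ?_, fun i => ?_, h.2.2.mapReg _⟩ <;>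
    obtain ⟨i, rfl⟩ := σ.surjective i
  · rw [regCount_mapReg]; exact h.1 i
  · rw [regCount_mapReg, surfRegCount_mapReg]; exact h.2.1 i

theorem Op.Fresh.mapReg (h : o.Fresh M) (σ : Equiv.Perm ℕ) :
    (o.mapReg σ).Fresh (M.mapReg σ) := by
  intro i hi
  cases o with
  | new j => cases hi; rw [regCount_mapReg]; exact h j rfl
  | _ => cases hi

theorem Term.exists_fresh (M : Term G) : ∃ n, ∀ i, n ≤ i → M.regCount i = 0 := by
  induction M with
  | reg i => exact ⟨i + 1, fun j hj => by simp [regCount]; omega⟩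
  | app M N ih ih' =>
    obtain ⟨n, hn⟩ := ih
    obtain ⟨n', hn'⟩ := ih'
    exact ⟨n + n', fun j hj => by simp [regCount, hn j (by omega), hn' j (by omega)]⟩
  | meas P M N ih ih' ih'' =>
    obtain ⟨n, hn⟩ := ih
    obtain ⟨n', hn'⟩ := ih'
    obtain ⟨n'', hn''⟩ := ih''
    exact ⟨n + n' + n'', fun j hj => by
      simp [regCount, hn j (by omega), hn' j (by omega), hn'' j (by omega)]⟩
  | bang M ih => exact ih
  | lam M ih => exact ih
  | blam M ih => exact ih
  | _ => exact ⟨0, fun _ _ => rfl⟩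

/-- The term has a surface step. -/
def Term.Reducible (M : Term G) : Prop := ∃ o M₀ M₁, SurfRed o M M₀ M₁ ∧ o.Fresh M

theorem Term.Reducible.mapReg (h : M.Reducible) (σ : Equiv.Perm ℕ) :
    (M.mapReg σ).Reducible := by
  obtain ⟨o, M₀, M₁, h, ho⟩ := h
  exact ⟨_, _, _, h.mapReg σ, ho.mapReg σ⟩

theorem Term.reducible_mapReg (σ : Equiv.Perm ℕ) : (M.mapReg σ).Reducible ↔ M.Reducible := by
  refine ⟨fun h => ?_, fun h => h.mapReg σ⟩
  have := h.mapReg σ.symm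
  simpa [mapReg_mapReg, mapReg_id] using this

/-- Valid terms with a memory in which only the registers of the term are used. -/
def Good (Q : State) (M : Term G) : Prop := M.Valid ∧ ∀ j, M.regCount j = 0 → Unused j Q

theorem Good.perm (h : Good Q M) (σ : Equiv.Perm ℕ) : Good (perm σ Q) (M.mapReg σ) := by
  refine ⟨h.1.mapReg σ, fun j hj => ?_⟩
  obtain ⟨j, rfl⟩ := σ.surjective j
  rw [regCount_mapReg] at hj
  intro s hs
  exact h.2 j hj _ (by simpa using hs)

theorem Good.step (hg : Good Q M) (h : SurfRed o M M₀ M₁) (ho : o.Fresh M) :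
    Good (o.kraus 0 Q) M₀ ∧ Good (o.kraus 1 Q) M₁ := by
  have hv := h.valid hg.1 ho
  have key : ∀ (b : Fin 2) (N : Term G) (j : ℕ), N.regCount j + o.consumed (delta j) =
      M.regCount j + o.created (delta j) → N.regCount j = 0 → Unused j (o.kraus b Q) := by
    intro b N j e hj
    -- A register that is read and yet absent from the result must be the measured one, whose qubit
    -- has been reset; an absent register that is not read was already absent before.
    by_cases hj' : j ∈ o.reads
    · have := h.regCount_pos hj'
      cases o with
      | meas i =>
        simp only [Op.reads, Finset.mem_singleton] at hj'
        subst hj'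
        exact Op.unused_kraus_meas _ _ _
      | _ => simp [Op.consumed] at e; omega
    · refine (hg.2 j ?_).act hj' _
      have : o.consumed (delta j) = 0 := by
        cases o with
        | meas i =>
          simp only [Op.reads, Finset.mem_singleton] at hj'
          simp [Op.consumed, delta, Ne.symm hj']
        | _ => rfl
      omega
  exact ⟨⟨hv.1, fun j hj => key 0 _ j (h.regCount_result hg.1 j).1 hj⟩,
    ⟨hv.2, fun j hj => key 1 _ j (h.regCount_result hg.1 j).2 hj⟩⟩

open Classical in
/-- The probability that a named program is in normal form after `k` steps of a fixed strategy. -/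
def value : ℕ → State → Term G → ℝ
  | 0, Q, M => if M.Reducible then 0 else normSq Q
  | k + 1, Q, M => if h : M.Reducible then
      value k (h.choose.kraus 0 Q) h.choose_spec.choose +
        value k (h.choose.kraus 1 Q) h.choose_spec.choose_spec.choose
    else normSq Q

theorem value_zero_of_reducible (h : M.Reducible) : value 0 Q M = 0 := by simp [value, h]

theorem value_of_not_reducible (h : ¬ M.Reducible) (k : ℕ) : value k Q M = normSq Q := by
  cases k <;> simp [value, h]

/-- Hides the choices made by the strategy; the chosen step depends on the term only, not on `k` or
the memory. -/
theorem exists_value_succ (h : M.Reducible) : ∃ o M₀ M₁, SurfRed o M M₀ M₁ ∧ o.Fresh M ∧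
    ∀ k Q, value (k + 1) Q M = value k (o.kraus 0 Q) M₀ + value k (o.kraus 1 Q) M₁ :=
  ⟨_, _, _, h.choose_spec.choose_spec.choose_spec.1, h.choose_spec.choose_spec.choose_spec.2,
    fun k Q => by rw [value, dif_pos h]⟩

/-- Turns the weight of a measurement outcome into a scalar on the unnormalized state. -/
theorem value_smul (k : ℕ) (z : ℂ) (Q : State) (M : Term G) :
    value k (z • Q) M = ‖z‖ ^ 2 * value k Q M := by
  by_cases h : M.Reducible
  · induction k generalizing Q M with
    | zero => simp [value_zero_of_reducible h]
    | succ k ih =>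
      have ih : ∀ (Q : State) (M : Term G), value k (z • Q) M = ‖z‖ ^ 2 * value k Q M := by
        intro Q M
        by_cases h : M.Reducible
        · exact ih Q M h
        · simp only [value_of_not_reducible h, normSq_smul]
      obtain ⟨o, M₀, M₁, -, -, e⟩ := exists_value_succ h
      rw [e, e, Op.kraus_smul, Op.kraus_smul, ih, ih]
      ring
  · simp only [value_of_not_reducible h, normSq_smul]

theorem value_zero_state (k : ℕ) (M : Term G) : value k 0 M = 0 := by
  simpa using value_smul k 0 0 M

theorem value_nonneg (k : ℕ) (Q : State) (M : Term G) : 0 ≤ value k Q M := by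
  by_cases h : M.Reducible
  · induction k generalizing Q M with
    | zero => simp [value_zero_of_reducible h]
    | succ k ih =>
      have ih : ∀ (Q : State) (M : Term G), 0 ≤ value k Q M := by
        intro Q M
        by_cases h : M.Reducible
        · exact ih Q M h
        · simp only [value_of_not_reducible h, normSq_nonneg]
      obtain ⟨o, M₀, M₁, -, -, e⟩ := exists_value_succ h
      rw [e]
      exact add_nonneg (ih _ _) (ih _ _)
  · simp only [value_of_not_reducible h, normSq_nonneg]

theorem value_le_succ (k : ℕ) (Q : State) (M : Term G) : value k Q M ≤ value (k + 1) Q M := by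
  by_cases h : M.Reducible
  · induction k generalizing Q M with
    | zero => rw [value_zero_of_reducible h]; exact value_nonneg _ _ _
    | succ k ih =>
      have ih : ∀ (Q : State) (M : Term G), value k Q M ≤ value (k + 1) Q M := by
        intro Q M
        by_cases h : M.Reducible
        · exact ih Q M h
        · simp only [value_of_not_reducible h, le_refl]
      obtain ⟨o, M₀, M₁, -, -, e⟩ := exists_value_succ h
      rw [e, e]
      exact add_le_add (ih _ _) (ih _ _)
  · simp only [value_of_not_reducible h, le_refl]

/-- If values after `k` steps are invariant under renaming, and values after fewer steps do not
depend on the strategy, then neither does the value after `k + 1` steps. -/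
theorem value_step_aux (k : ℕ)
    (hR : ∀ (σ : Equiv.Perm ℕ) (Q : State) (M : Term G), Good Q M →
      value k (perm σ Q) (M.mapReg σ) = value k Q M)
    (hP : ∀ l, k = l + 1 → ∀ (o : Op G) (Q : State) (M M₀ M₁ : Term G), Good Q M →
      SurfRed o M M₀ M₁ → o.Fresh M →
      value l (o.kraus 0 Q) M₀ + value l (o.kraus 1 Q) M₁ = value (l + 1) Q M)
    (hg : Good Q M) (h : SurfRed o M M₀ M₁) (ho : o.Fresh M)
    (h' : SurfRed o' M M₀' M₁') (ho' : o'.Fresh M) :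
    value k (o.kraus 0 Q) M₀ + value k (o.kraus 1 Q) M₁ =
      value k (o'.kraus 0 Q) M₀' + value k (o'.kraus 1 Q) M₁' := by
  have hrename : ∀ (i j : ℕ) (N : Term G), M.regCount i = 0 → M.regCount j = 0 →
      Good ((Op.new i : Op G).kraus 0 Q) N →
      value k ((Op.new j : Op G).kraus 0 Q) (N.mapReg (Equiv.swap i j)) =
        value k ((Op.new i : Op G).kraus 0 Q) N := by
    intro i j N hi hj hN
    rw [Op.kraus_new] at hN ⊢
    rw [Op.kraus_new, ← hR (Equiv.swap i j) Q N hN, perm_swap (hg.2 i hi) (hg.2 j hj)]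
  have main : ∀ (o' : Op G) (M₀' M₁' : Term G), SurfRed o' M M₀' M₁' → o'.Fresh M →
      (∀ i, o = .new i → o' ≠ .new i) →
      value k (o.kraus 0 Q) M₀ + value k (o.kraus 1 Q) M₁ =
        value k (o'.kraus 0 Q) M₀' + value k (o'.kraus 1 Q) M₁' := by
    intro o' M₀' M₁' h' ho' hne
    rcases h.diamond h' hg.1.2.2 hg.1.1 ho ho' with hs | hc
    · obtain ⟨rfl, rfl, rfl⟩ | ⟨i, j, rfl, rfl, rfl, rfl⟩ := hs
      · rfl
      · rw [hrename i j M₀ (ho i rfl) (ho' j rfl) (hg.step h ho).1]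
        rw [Op.kraus_one _ (by simp), Op.kraus_one _ (by simp), value_zero_state,
          value_zero_state]
    · obtain ⟨hd, N₀₀, N₀₁, N₁₀, N₁₁, h₀, h₁, h₀', h₁'⟩ := hc
      -- The residual of the other step may be performed with the same name, as the first step did
      -- not create that name.
      have fresh : ∀ {o o' : Op G} {M₀ M₁ : Term G}, (∀ i, o = .new i → o' ≠ .new i) →
          SurfRed o M M₀ M₁ → o'.Fresh M → o'.Fresh M₀ ∧ o'.Fresh M₁ := by
        intro o o' M₀ M₁ hne h ho'
        have key : ∀ i, o' = .new i → o.created (delta i) = 0 := by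
          intro i hi
          cases o with
          | new j =>
            have : j ≠ i := by rintro rfl; exact hne j rfl hi
            simp [Op.created, delta, this]
          | _ => rfl
        constructor <;>
        · intro i hi
          have := key i hi
          have := ho' i hi
          have := h.regCount_result hg.1 i
          omega
      obtain ⟨f₀, f₁⟩ := fresh hne h ho'
      obtain ⟨f₀', f₁'⟩ := fresh (fun i hi hi' => hne i hi' hi) h' ho
      obtain ⟨g₀, g₁⟩ := hg.step h ho
      obtain ⟨g₀', g₁'⟩ := hg.step h' ho'
      cases k with
      | zero =>
        -- With no steps left, all four results still contain the other redex, so every value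
        -- vanishes.
        rw [value_zero_of_reducible ⟨_, _, _, h₀, f₀⟩, value_zero_of_reducible ⟨_, _, _, h₁, f₁⟩,
          value_zero_of_reducible ⟨_, _, _, h₀', f₀'⟩,
          value_zero_of_reducible ⟨_, _, _, h₁', f₁'⟩]
      | succ l =>
        have hP := hP l rfl
        rw [← hP _ _ _ _ _ g₀ h₀ f₀, ← hP _ _ _ _ _ g₁ h₁ f₁, ← hP _ _ _ _ _ g₀' h₀' f₀',
          ← hP _ _ _ _ _ g₁' h₁' f₁']
        simp only [Op.kraus_comm hd]
        ring
  by_cases hne : ∀ i, o = .new i → o' ≠ .new i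
  · exact main o' M₀' M₁' h' ho' hne
  · push Not at hne
    obtain ⟨i, rfl, rfl⟩ := hne
    -- Two different `new` redexes may be given the same name `i`, which is no longer fresh for the
    -- second after the first. The second is renamed to `n + i + 1`, which is fresh and differs from
    -- `i`.
    obtain ⟨n, hn⟩ := M.exists_fresh
    have hi := ho i rfl
    have hj : M.regCount (n + i + 1) = 0 := hn _ (by omega)
    have h'' := h'.mapReg (Equiv.swap i (n + i + 1))
    rw [SurfRed.mapReg_swap_of_fresh hi hj] at h''
    simp only [Op.mapReg, Equiv.swap_apply_left] at h''
    rw [main _ _ _ h'' (fun k hk => by cases hk; exact hj) (fun k hk hk' => by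
      cases hk
      simp only [Op.new.injEq] at hk'
      omega)]
    rw [hrename _ _ _ hi hj (hg.step h' ho').1, Op.kraus_one _ (by simp),
      Op.kraus_one _ (by simp), value_zero_state, value_zero_state]

/-- The two claims need each other: strategy independence uses invariance at `k` to change fresh
names and independence at the previous level to close diamonds. Invariance at `k + 1` uses
independence at `k`, since the strategy need not choose corresponding steps in a term and its
renaming. -/
theorem value_perm_and_step (k : ℕ) :
    (∀ (σ : Equiv.Perm ℕ) (Q : State) (M : Term G), Good Q M →
      value k (perm σ Q) (M.mapReg σ) = value k Q M) ∧
    ∀ (o : Op G) (Q : State) (M M₀ M₁ : Term G), Good Q M →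
      SurfRed o M M₀ M₁ → o.Fresh M →
      value k (o.kraus 0 Q) M₀ + value k (o.kraus 1 Q) M₁ = value (k + 1) Q M := by
  induction k with
  | zero =>
    have hR : ∀ (σ : Equiv.Perm ℕ) (Q : State) (M : Term G), Good Q M →
        value 0 (perm σ Q) (M.mapReg σ) = value 0 Q M := by
      intro σ Q M _
      by_cases hr : M.Reducible
      · rw [value_zero_of_reducible hr, value_zero_of_reducible (hr.mapReg σ)]
      · have hr' : ¬ (M.mapReg σ).Reducible := by rwa [reducible_mapReg]
        rw [value_of_not_reducible hr, value_of_not_reducible hr', normSq_perm]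
    refine ⟨hR, fun o Q M M₀ M₁ hg h ho => ?_⟩
    obtain ⟨o', M₀', M₁', h', ho', e⟩ := exists_value_succ ⟨_, _, _, h, ho⟩
    rw [e]
    exact value_step_aux 0 hR (by simp) hg h ho h' ho'
  | succ k ih =>
    have hR : ∀ (σ : Equiv.Perm ℕ) (Q : State) (M : Term G), Good Q M →
        value (k + 1) (perm σ Q) (M.mapReg σ) = value (k + 1) Q M := by
      intro σ Q M hg
      by_cases hr : M.Reducible
      · obtain ⟨o, M₀, M₁, h, ho, e⟩ := exists_value_succ hr
        rw [e, ← ih.2 _ _ _ _ _ (hg.perm σ) (h.mapReg σ) (ho.mapReg σ), Op.kraus_mapReg,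
          Op.kraus_mapReg, ih.1 _ _ _ (hg.step h ho).1, ih.1 _ _ _ (hg.step h ho).2]
      · have hr' : ¬ (M.mapReg σ).Reducible := by rwa [reducible_mapReg]
        rw [value_of_not_reducible hr, value_of_not_reducible hr', normSq_perm]
    refine ⟨hR, fun o Q M M₀ M₁ hg h ho => ?_⟩
    obtain ⟨o', M₀', M₁', h', ho', e⟩ := exists_value_succ ⟨_, _, _, h, ho⟩
    rw [e]
    exact value_step_aux (k + 1) hR (fun l hl => by cases hl; exact ih.2) hg h ho h' ho'

theorem value_perm (k : ℕ) (σ : Equiv.Perm ℕ) (hg : Good Q M) :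
    value k (perm σ Q) (M.mapReg σ) = value k Q M := (value_perm_and_step k).1 σ Q M hg

theorem value_step (k : ℕ) (hg : Good Q M) (h : SurfRed o M M₀ M₁) (ho : o.Fresh M) :
    value k (o.kraus 0 Q) M₀ + value k (o.kraus 1 Q) M₁ = value (k + 1) Q M :=
  (value_perm_and_step k).2 o Q M M₀ M₁ hg h ho

end Value

open State Term

/-! ### Embedding of memories -/

namespace QVec

variable {n : ℕ}

/-- The state of the registers `r₀, …, r_{n-1}`; all other qubits are `|0⟩`. -/
def embed (Q : QVec n) : State :=
  fun s => if s ⊆ Finset.range n then Q (fun i => bit i s) else 0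

theorem embed_smul (z : ℂ) (Q : QVec n) : embed (z • Q) = z • embed Q := by
  funext s; simp [embed]

theorem unused_embed (Q : QVec n) {j : ℕ} (hj : n ≤ j) : Unused j (embed Q) := by
  intro s hs
  rw [embed, if_neg]
  intro h
  have := Finset.mem_range.1 (h hs)
  omega

/-- The allocated qubit is one of the idle `|0⟩` qubits already present in the embedding. -/
theorem embed_tensorKet (Q : QVec n) : embed (Q.tensorKet 0) = embed Q := by
  funext s
  simp only [embed, tensorKet, Fin.val_last, Fin.val_castSucc]
  by_cases h : s ⊆ Finset.range n
  · have h' : s ⊆ Finset.range (n + 1) := h.trans (by simp)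
    have : n ∉ s := fun hn => by simpa using h hn
    simp [h, h', bit, this]
  · rw [if_neg h]
    split_ifs with h1 h2
    · exfalso
      apply h
      intro x hx
      have h3 := Finset.mem_range.1 (h1 hx)
      rcases eq_or_ne x n with rfl | hne
      · simp [bit, hx] at h2
      · exact Finset.mem_range.2 (by omega)
    · rfl
    · rfl

/-- The unnormalized state after a measurement of the last qubit with outcome `c`. -/
def proj (c : Fin 2) (Q : QVec (n + 1)) : QVec n :=
  WithLp.toLp 2 fun b => Q (Fin.snoc (α := fun _ => Fin 2) b c)

/-- The decomposition in the measurement rule is not unique (phases, null outcomes), but the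
unnormalized vectors `αᵢ • Qᵢ` are determined by the memory. -/
theorem proj_decomp (α₀ α₁ : ℂ) (Q₀ Q₁ : QVec n) :
    proj 0 (α₀ • Q₀.tensorKet 0 + α₁ • Q₁.tensorKet 1) = α₀ • Q₀ ∧
    proj 1 (α₀ • Q₀.tensorKet 0 + α₁ • Q₁.tensorKet 1) = α₁ • Q₁ := by
  constructor <;> ext b <;> simp [proj, tensorKet]

theorem sum_powerset_singleton (i : ℕ) (f : Finset ℕ → ℂ) :
    ∑ t ∈ ({i} : Finset ℕ).powerset, f t = f ∅ + f {i} := by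
  rw [← insert_empty_eq, Finset.sum_powerset_insert (by simp)]
  simp

variable {G : GateSet.{u}}

/-- Resetting the measured qubit to `|0⟩` has the same effect as deleting it, because idle qubits of
an embedded memory are `|0⟩`. -/
theorem embed_proj (c : Fin 2) (Q : QVec (n + 1)) :
    (Op.meas n : Op G).kraus c (embed Q) = embed (proj c Q) := by
  funext s
  rw [Op.kraus, Op.reads, act, sum_powerset_singleton]
  by_cases hs : s ⊆ Finset.range n
  · have hn : n ∉ s := fun hn => by simpa using hs hn
    have e0 : s \ {n} = s := Finset.sdiff_eq_self_of_disjoint (by simpa using hn)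
    have e1 : s ∩ {n} = ∅ := Finset.inter_singleton_of_notMem hn
    have h' : s ⊆ Finset.range (n + 1) := hs.trans (by simp)
    have h'' : insert n s ⊆ Finset.range (n + 1) := by
      rw [Finset.insert_subset_iff]; exact ⟨by simp, h'⟩
    rw [e0, e1]
    have key : ∀ (t : Finset ℕ), t ⊆ {n} →
        (fun i : Fin (n + 1) => bit i (s ∪ t)) =
          Fin.snoc (α := fun _ => Fin 2) (fun i : Fin n => bit i s) (bit n t) := by
      intro t ht
      funext i
      refine Fin.lastCases ?_ (fun i => ?_) i
      · simp [bit, hn]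
      · have : (i : ℕ) ∉ t := fun hi => by
          have := Finset.mem_singleton.1 (ht hi)
          omega
        simp [bit, this]
    have k0 := key ∅ (by simp)
    have k1 := key {n} (by simp)
    have b0 : bit n ∅ = 0 := by simp [bit]
    have b1 : bit n {n} = 1 := by simp [bit]
    rw [b0] at k0
    rw [b1] at k1
    have h3 : s ∪ ∅ ⊆ Finset.range (n + 1) := by simpa using h'
    have h4 : s ∪ {n} ⊆ Finset.range (n + 1) := by
      rw [Finset.union_singleton]; exact h''
    simp only [embed, proj, h3, h4, hs, if_true, k0, k1, Op.kernel, b0, b1]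
    fin_cases c <;> simp
  · simp only [embed, hs, if_false]
    by_cases hn : n ∈ s
    · have : s ∩ {n} ≠ ∅ := by
        rw [Finset.inter_singleton_of_mem hn]
        exact Finset.singleton_ne_empty _
      simp [Op.kernel, this]
    · have key : ∀ t, ¬ (s \ {n} ∪ t ⊆ Finset.range (n + 1)) := by
        intro t ht
        apply hs
        intro x hx
        have hxn : x ≠ n := by rintro rfl; exact hn hx
        have := Finset.mem_range.1
          (ht (Finset.mem_union_left _ (Finset.mem_sdiff.2 ⟨hx, by simpa using hxn⟩)))
        exact Finset.mem_range.2 (by omega)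
      simp only [key, if_false, mul_zero, add_zero]

theorem embed_apply1 (A : G.Unary) (Q : QVec (n + 1)) :
    (Op.gate1 A 0).kraus 0 (embed Q) = embed (Q.apply1 (G.mat1 A).1) := by
  funext s
  rw [Op.kraus, Op.reads, act, sum_powerset_singleton]
  have sub : ∀ t, t ⊆ {0} → (s \ {0} ∪ t ⊆ Finset.range (n + 1) ↔ s ⊆ Finset.range (n + 1)) := by
    intro t ht
    constructor
    · intro h x hx
      by_cases hx0 : x = 0
      · simp [hx0]
      · exact h (by simp [hx, hx0])
    · intro h x hx
      rcases Finset.mem_union.1 hx with hx | hx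
      · exact h (Finset.mem_sdiff.1 hx).1
      · have := Finset.mem_singleton.1 (ht hx); simp [this]
  have key : ∀ t, t ⊆ {0} → (fun i : Fin (n + 1) => bit i (s \ {0} ∪ t)) =
      Function.update (fun i : Fin (n + 1) => bit i s) 0 (bit 0 t) := by
    intro t ht
    funext i
    by_cases hi : i = 0
    · subst hi; simp [bit]
    · have hi' : (i : ℕ) ≠ 0 := fun h => hi (Fin.ext h)
      have : (i : ℕ) ∉ t := fun h => hi' (by simpa using ht h)
      simp [bit, hi, this]
  have b : bit 0 (s ∩ {0}) = bit 0 s := by simp [bit]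
  have b0 : bit 0 ∅ = 0 := by simp [bit]
  have b1 : bit 0 {0} = 1 := by simp [bit]
  simp only [embed, sub ∅ (by simp), sub {0} (by simp), key ∅ (by simp), key {0} (by simp),
    Op.kernel, if_true, apply1, b, b0, b1, Fin.sum_univ_two]
  split_ifs <;> simp

theorem embed_apply2 (A : G.Binary) (Q : QVec (n + 2)) :
    (Op.gate2 A 0 1).kraus 0 (embed Q) = embed (Q.apply2 (G.mat2 A).1) := by
  funext s
  rw [Op.kraus, Op.reads, act, Finset.sum_powerset_insert (by simp), sum_powerset_singleton,
    sum_powerset_singleton]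
  have sub : ∀ t, t ⊆ {0, 1} →
      (s \ {0, 1} ∪ t ⊆ Finset.range (n + 2) ↔ s ⊆ Finset.range (n + 2)) := by
    intro t ht
    constructor
    · intro h x hx
      by_cases hx0 : x = 0 ∨ x = 1
      · rcases hx0 with rfl | rfl <;> simp
      · exact h (by simp [hx, hx0])
    · intro h x hx
      rcases Finset.mem_union.1 hx with hx | hx
      · exact h (Finset.mem_sdiff.1 hx).1
      · have := ht hx
        simp only [Finset.mem_insert, Finset.mem_singleton] at this
        rcases this with rfl | rfl <;> simp
  have key : ∀ t, t ⊆ {0, 1} → (fun i : Fin (n + 2) => bit i (s \ {0, 1} ∪ t)) =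
      Function.update (Function.update (fun i : Fin (n + 2) => bit i s) 0 (bit 0 t)) 1
        (bit 1 t) := by
    intro t ht
    funext i
    by_cases hi1 : i = 1
    · subst hi1; simp [bit]
    by_cases hi : i = 0
    · subst hi; simp [bit]
    · have hi' : (i : ℕ) ≠ 0 := fun h => hi (Fin.ext h)
      have hi1' : (i : ℕ) ≠ 1 := fun h => hi1 (Fin.ext h)
      have : (i : ℕ) ∉ t := fun h => by
        have := ht h
        simp [hi', hi1'] at this
      simp [bit, hi, hi1, hi', hi1', this]
  have b : bit 0 (s ∩ {0, 1}) = bit 0 s := by simp [bit]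
  have b' : bit 1 (s ∩ {0, 1}) = bit 1 s := by simp [bit]
  have b0 : ∀ i, bit i ∅ = 0 := by simp [bit]
  have b1 : ∀ i j, bit i {j} = if i = j then 1 else 0 := by simp [bit]
  have b2 : ∀ i, bit i (insert 0 {1}) = if i = 0 ∨ i = 1 then 1 else 0 := by simp [bit]
  simp only [embed, sub ∅ (by simp), sub {1} (by simp),
    sub (insert 0 {1}) subset_rfl, sub (insert 0 ∅) (by simp),
    key ∅ (by simp), key {1} (by simp), key (insert 0 ∅) (by simp),
    key (insert 0 {1}) subset_rfl, Op.kernel, if_true, apply2, b, b',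
    Fintype.sum_prod_type, Fin.sum_univ_two]
  split_ifs
  · simp [b0, b1, b2]
  · simp

/-- The permutation of register identifiers that extends a permutation of `{0, …, n-1}`. -/
def _root_.QLam.natPerm (σ : Equiv.Perm (Fin n)) : Equiv.Perm ℕ where
  toFun := extendPerm σ
  invFun := extendPerm σ⁻¹
  left_inv i := by
    have := congrFun (extendPerm_mul σ σ⁻¹) i
    simpa [extendPerm_one] using this
  right_inv i := by
    have := congrFun (extendPerm_mul σ⁻¹ σ) i
    simpa [extendPerm_one] using this

theorem _root_.QLam.natPerm_lt (σ : Equiv.Perm (Fin n)) (i : ℕ) : natPerm σ i < n ↔ i < n := by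
  by_cases h : i < n <;> simp [natPerm, extendPerm, h]

theorem embed_permute (σ : Equiv.Perm (Fin n)) (Q : QVec n) :
    embed (Q.permute σ) = perm (natPerm σ) (embed Q) := by
  funext s
  have e : s.map (natPerm σ).symm.toEmbedding ⊆ Finset.range n ↔ s ⊆ Finset.range n := by
    simp only [Finset.subset_iff, Finset.mem_map_equiv, Equiv.symm_symm, Finset.mem_range]
    constructor
    · intro h x hx
      have := @h ((natPerm σ).symm x) (by simpa using hx)
      rw [← natPerm_lt σ] at this
      simpa using this
    · intro h x hx
      exact (natPerm_lt σ x).1 (h hx)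
  simp only [embed, perm, e, permute]
  split_ifs with h
  · refine congrArg Q (funext fun i => ?_)
    simp only [bit, Finset.mem_map_equiv, Equiv.symm_symm]
    simp [natPerm, extendPerm]
  · rfl

theorem normSq_embed (Q : QVec n) : normSq (embed Q) = ‖Q‖ ^ 2 := by
  rw [normSq, EuclideanSpace.norm_sq_eq, tsum_eq_sum (s := (Finset.range n).powerset)]
  · refine Finset.sum_nbij' (fun s => fun i : Fin n => bit i s)
      (fun b => (Finset.univ.filter fun i => b i = 1).map Fin.valEmbedding) ?_ ?_ ?_ ?_ ?_
    · simp
    · intro b _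
      rw [Finset.mem_powerset]
      intro x hx
      simp only [Finset.mem_map, Fin.valEmbedding_apply] at hx
      obtain ⟨i, -, rfl⟩ := hx
      simp
    · intro s hs
      rw [Finset.mem_powerset] at hs
      ext x
      simp only [Finset.mem_map, Finset.mem_filter, Finset.mem_univ, true_and,
        Fin.valEmbedding_apply]
      constructor
      · rintro ⟨i, hi, rfl⟩
        by_contra h
        simp [bit, h] at hi
      · intro hx
        exact ⟨⟨x, by simpa using hs hx⟩, by simp [bit, hx], rfl⟩
    · intro b _
      funext i
      simp only [bit, Finset.mem_map, Finset.mem_filter, Finset.mem_univ, true_and,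
        Fin.valEmbedding_apply, ← Fin.ext_iff, exists_eq_right]
      split_ifs with h
      · exact h.symm
      · omega
    · intro s hs
      rw [Finset.mem_powerset] at hs
      simp [embed, hs]
  · intro s hs
    rw [Finset.mem_powerset] at hs
    simp [embed, hs]

end QVec

/-! ### Values of programs -/

variable {G : GateSet.{u}}

theorem SurfRed.fill {o : Op G} {M M₀ M₁ : Term G} (h : SurfRed o M M₀ M₁) (S : SurfCtx G) :
    SurfRed o (S.fill M) (S.fill M₀) (S.fill M₁) := by
  induction S with
  | hole => exact h
  | appR M S ih => exact .appR _ ih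
  | appL S M ih => exact .appL _ ih
  | lam S ih => exact .lam ih
  | blam S ih => exact .blam ih
  | meas S M N ih => exact .measP _ _ ih

/-- The value of a configuration. -/
def Config.value (k : ℕ) (c : Config G) : ℝ := QLam.value k c.mem.embed c.term

theorem RootBeta.surfRed {M M' : Term G} (h : RootBeta M M') : SurfRed .silent M M' M' := by
  cases h with
  | lin M N => exact .beta M N
  | bang M N => exact .bbeta M N

theorem value_single {o : Op G} (ho : ∀ i, o ≠ .meas i) (k : ℕ) (Q : State) (M₀ M₁ : Term G) :
    QLam.value k (o.kraus 0 Q) M₀ + QLam.value k (o.kraus 1 Q) M₁ =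
      QLam.value k (o.kraus 0 Q) M₀ := by
  rw [Op.kraus_one _ ho, value_zero_state, add_zero]

/-- The surrounding context is kept inside the formula since values are not compositional. A created
register is named by the memory size, which makes it fresh in programs. -/
theorem RootQuantum.surfRed {c : Config G} {d : Multiset (ℝ × Config G)} (h : RootQuantum c d) :
    ∃ o M₀ M₁, SurfRed o c.term M₀ M₁ ∧ (∀ i, o = .new i → i = c.size) ∧
      ∀ k (S : SurfCtx G),
        (d.map fun x => x.1 * QLam.value k x.2.mem.embed (S.fill x.2.term)).sum =
          QLam.value k (o.kraus 0 c.mem.embed) (S.fill M₀) +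
            QLam.value k (o.kraus 1 c.mem.embed) (S.fill M₁) := by
  cases h with
  | new n Q =>
    refine ⟨_, _, _, .new n, by simp, fun k S => ?_⟩
    rw [value_single (by simp)]
    simp [Op.kraus_new, QVec.embed_tensorKet]
  | meas n Q α₀ α₁ Q₀ Q₁ M N h₀ h₁ decomp =>
    refine ⟨_, _, _, .meas n M N, by simp, fun k S => ?_⟩
    have e := QVec.proj_decomp α₀ α₁ Q₀ Q₁
    rw [← decomp] at e
    simp only [QVec.embed_proj, e.1, e.2, QVec.embed_smul, value_smul]
    -- Omitted outcomes have weight 0 and contribute nothing to the sum.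
    have key : ∀ d : Multiset (ℝ × Config G),
        ((d.filter fun x => x.1 ≠ 0).map fun x =>
          x.1 * QLam.value k x.2.mem.embed (S.fill x.2.term)).sum =
        (d.map fun x => x.1 * QLam.value k x.2.mem.embed (S.fill x.2.term)).sum := by
      intro d
      induction d using Multiset.induction with
      | empty => rfl
      | cons a d ih =>
        by_cases ha : a.1 = 0
        · rw [Multiset.filter_cons_of_neg (p := fun x : ℝ × Config G => x.1 ≠ 0) _
            (by simpa using ha), ih]
          simp [ha]
        · rw [Multiset.filter_cons_of_pos (p := fun x : ℝ × Config G => x.1 ≠ 0) _ ha,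
            Multiset.map_cons, Multiset.sum_cons, ih]
          simp
    rw [key]
    simp
  | unary n Q A =>
    refine ⟨_, _, _, .gate1 A 0, by simp, fun k S => ?_⟩
    rw [value_single (by simp)]
    simp [QVec.embed_apply1]
  | binary n Q A =>
    refine ⟨_, _, _, .gate2 A 0 1, by simp, fun k S => ?_⟩
    rw [value_single (by simp), QVec.embed_apply2]
    simp
    rfl

theorem CtxStep.surfRed {c : Config G} {d : Multiset (ℝ × Config G)} (h : CtxStep c d)
    (hc : c.term.regCount c.size = 0) :
    ∃ o M₀ M₁, SurfRed o c.term M₀ M₁ ∧ o.Fresh c.term ∧ ∀ k,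
      (d.map fun x => x.1 * x.2.value k).sum =
        QLam.value k (o.kraus 0 c.mem.embed) M₀ + QLam.value k (o.kraus 1 c.mem.embed) M₁ := by
  cases h with
  | beta n Q S M M' h =>
    refine ⟨_, _, _, h.surfRed.fill S, fun i hi => (by cases hi), fun k => ?_⟩
    rw [value_single (by simp)]
    simp [Op.kraus_silent, Config.value]
  | quantum n Q S M d h =>
    obtain ⟨o, M₀, M₁, h, ho, e⟩ := h.surfRed
    refine ⟨o, _, _, h.fill S, fun i hi => ?_, fun k => ?_⟩
    · rw [ho i hi]; exact hc
    · rw [← e, Multiset.map_map]; rfl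

theorem RawProgram.regCount_of_le (p : RawProgram G) {j : ℕ} (hj : p.size ≤ j) :
    p.term.regCount j = 0 := by
  have := p.regs j
  omega

theorem RawProgram.good (p : RawProgram G) : Good p.mem.embed p.term := by
  refine ⟨p.valid, fun j hj => QVec.unused_embed _ ?_⟩
  have := p.regs j
  omega

theorem CtxStep.sum_value {p : RawProgram G} {d : Multiset (ℝ × Config G)}
    (h : CtxStep p.toConfig d) :
    p.term.Reducible ∧ ∀ k, (d.map fun x => x.1 * x.2.value k).sum = p.toConfig.value (k + 1) := by
  obtain ⟨o, M₀, M₁, h, ho, e⟩ := h.surfRed (p.regCount_of_le le_rfl)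
  exact ⟨⟨_, _, _, h, ho⟩, fun k => (e k).trans (value_step k p.good h ho)⟩

theorem RawProgram.value_reindex (k : ℕ) (p : RawProgram G) (σ : Equiv.Perm (Fin p.size)) :
    (p.toConfig.reindex σ).value k = p.toConfig.value k := by
  rw [Config.value, Config.value, Config.reindex]
  dsimp only
  rw [QVec.embed_permute]
  exact value_perm k (natPerm σ) p.good

/-- The value of a program. -/
def Program.value (k : ℕ) (e : Program G) : ℝ :=
  Quotient.lift (fun p : RawProgram G => p.toConfig.value k)
    (fun p q h => by
      obtain ⟨σ, h⟩ := h
      simp only [h, p.value_reindex]) e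

theorem SurfStep.sum_value {e : Program G} {m : MDist (Program G)} (h : SurfStep e m) (k : ℕ) :
    (m.val.map fun x => x.1 * x.2.value k).sum = e.value (k + 1) := by
  obtain ⟨p, d, rfl, h, hm⟩ := h
  have := h.sum_value.2 k
  rw [Multiset.map_map] at this
  rw [hm, Multiset.map_map]
  exact this

/-! ### Norms -/

namespace QVec

variable {n : ℕ}

/-- Both sides are `star w ⬝ᵥ w`, for `w = U v` and `w = v`, and `star U * U = 1`. The gate lemmas
apply this for each fixed assignment of the other bits. -/
theorem sum_norm_sq_mulVec {ι : Type*} [Fintype ι] [DecidableEq ι]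
    (U : Matrix.unitaryGroup ι ℂ) (v : ι → ℂ) :
    ∑ i, ‖∑ j, U.1 i j * v j‖ ^ 2 = ∑ i, ‖v i‖ ^ 2 := by
  have key : ∀ w : ι → ℂ, ((∑ i, ‖w i‖ ^ 2 : ℝ) : ℂ) = star w ⬝ᵥ w := by
    intro w
    simp only [dotProduct, Pi.star_apply, RCLike.star_def, Complex.conj_mul', Complex.ofReal_sum,
      Complex.ofReal_pow]
  have h := key (Matrix.mulVec U.1 v)
  rw [Matrix.star_mulVec, Matrix.dotProduct_mulVec, Matrix.vecMul_vecMul,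
    ← Matrix.star_eq_conjTranspose, Matrix.UnitaryGroup.star_mul_self, Matrix.vecMul_one,
    ← key v] at h
  exact_mod_cast h

theorem norm_apply1 (U : Matrix.unitaryGroup (Fin 2) ℂ) (Q : QVec (n + 1)) :
    ‖Q.apply1 U.1‖ = ‖Q‖ := by
  rw [← sq_eq_sq₀ (norm_nonneg _) (norm_nonneg _), EuclideanSpace.norm_sq_eq,
    EuclideanSpace.norm_sq_eq, ← (Fin.consEquiv fun _ => Fin 2).sum_comp,
    ← (Fin.consEquiv fun _ => Fin 2).sum_comp, Fintype.sum_prod_type_right,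
    Fintype.sum_prod_type_right]
  refine Finset.sum_congr rfl fun r _ => ?_
  refine Eq.trans ?_ (sum_norm_sq_mulVec U fun c => Q (Fin.cons (α := fun _ => Fin 2) c r))
  simp [apply1, Fin.consEquiv]

theorem norm_apply2 (U : Matrix.unitaryGroup (Fin 2 × Fin 2) ℂ) (Q : QVec (n + 2)) :
    ‖Q.apply2 U.1‖ = ‖Q‖ := by
  let e : ((Fin 2 × Fin 2) × (Fin n → Fin 2)) ≃ (Fin (n + 2) → Fin 2) :=
    (Equiv.prodAssoc _ _ _).trans (((Equiv.refl _).prodCongr (Fin.consEquiv fun _ => Fin 2)).trans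
      (Fin.consEquiv fun _ => Fin 2))
  have he : ∀ c r, e (c, r) =
      Fin.cons (α := fun _ => Fin 2) c.1 (Fin.cons (α := fun _ => Fin 2) c.2 r) := fun _ _ => rfl
  have hu : ∀ (c c' : Fin 2 × Fin 2) r,
      Function.update (Function.update (e (c, r)) 0 c'.1) 1 c'.2 = e (c', r) := by
    intro c c' r
    rw [he, he, Fin.update_cons_zero, ← Fin.succ_zero_eq_one, ← Fin.cons_update,
      Fin.update_cons_zero]
  rw [← sq_eq_sq₀ (norm_nonneg _) (norm_nonneg _), EuclideanSpace.norm_sq_eq,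
    EuclideanSpace.norm_sq_eq, ← e.sum_comp, ← e.sum_comp, Fintype.sum_prod_type_right,
    Fintype.sum_prod_type_right]
  refine Finset.sum_congr rfl fun r _ => ?_
  refine Eq.trans ?_ (sum_norm_sq_mulVec U fun c => Q (e (c, r)))
  refine Finset.sum_congr rfl fun c _ => ?_
  simp only [apply2, hu]
  rfl

theorem norm_tensorKet (Q : QVec n) : ‖Q.tensorKet 0‖ = ‖Q‖ := by
  rw [← sq_eq_sq₀ (norm_nonneg _) (norm_nonneg _), ← normSq_embed, ← normSq_embed,
    embed_tensorKet]

theorem norm_permute (σ : Equiv.Perm (Fin n)) (Q : QVec n) : ‖Q.permute σ‖ = ‖Q‖ := by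
  rw [← sq_eq_sq₀ (norm_nonneg _) (norm_nonneg _), ← normSq_embed, ← normSq_embed,
    embed_permute, normSq_perm]

theorem norm_sq_proj (Q : QVec (n + 1)) : ‖proj 0 Q‖ ^ 2 + ‖proj 1 Q‖ ^ 2 = ‖Q‖ ^ 2 := by
  simp only [EuclideanSpace.norm_sq_eq]
  rw [← (Fin.snocEquiv fun _ => Fin 2).sum_comp, Fintype.sum_prod_type, Fin.sum_univ_two]
  rfl

theorem exists_unit_smul (v : QVec n) : ∃ w : QVec n, ‖w‖ = 1 ∧ v = (‖v‖ : ℂ) • w := by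
  by_cases hv : v = 0
  -- An outcome of probability 0 still needs a normalized vector; `|0…0⟩` will do.
  · exact ⟨EuclideanSpace.single 0 1, by simp, by simp [hv]⟩
  · have hv' : (‖v‖ : ℂ) ≠ 0 := by simpa using hv
    refine ⟨(‖v‖ : ℂ)⁻¹ • v, ?_, by rw [smul_smul, mul_inv_cancel₀ hv', one_smul]⟩
    rw [norm_smul, norm_inv, Complex.norm_real, norm_norm]
    exact inv_mul_cancel₀ (by simpa using hv)

theorem eq_proj (Q : QVec (n + 1)) :
    Q = (proj 0 Q).tensorKet 0 + (proj 1 Q).tensorKet 1 := by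
  ext b
  have hb : b = Fin.snoc (α := fun _ => Fin 2) (fun i => b i.castSucc) (b (Fin.last n)) :=
    (Fin.snoc_init_self b).symm
  have key : ∀ c, b (Fin.last n) = c →
      Q b = Q (Fin.snoc (α := fun _ => Fin 2) (fun i => b i.castSucc) c) := by
    rintro c rfl; rw [← hb]
  rcases (show b (Fin.last n) = 0 ∨ b (Fin.last n) = 1 by omega) with h | h
  · simp [tensorKet, proj, h, key _ h]
  · simp [tensorKet, proj, h, key _ h]

theorem exists_decomp (Q : QVec (n + 1)) (hQ : ‖Q‖ = 1) : ∃ (α₀ α₁ : ℂ) (Q₀ Q₁ : QVec n),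
    ‖Q₀‖ = 1 ∧ ‖Q₁‖ = 1 ∧ Q = α₀ • Q₀.tensorKet 0 + α₁ • Q₁.tensorKet 1 ∧
      ‖α₀‖ ^ 2 + ‖α₁‖ ^ 2 = 1 := by
  obtain ⟨Q₀, h₀, e₀⟩ := exists_unit_smul (proj 0 Q)
  obtain ⟨Q₁, h₁, e₁⟩ := exists_unit_smul (proj 1 Q)
  refine ⟨‖proj 0 Q‖, ‖proj 1 Q‖, Q₀, Q₁, h₀, h₁, ?_, by
    rw [Complex.norm_real, Complex.norm_real, norm_norm, norm_norm, norm_sq_proj, hQ, one_pow]⟩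
  have hs : ∀ (z : ℂ) (P : QVec n) (c : Fin 2), (z • P).tensorKet c = z • P.tensorKet c := by
    intro z P c; ext b; simp [tensorKet]
  rw [← hs, ← hs, ← e₀, ← e₁]
  exact eq_proj Q

end QVec

/-! ### Reducible programs have surface steps -/

/-- The operation can be performed on a memory with `n` qubits without re-indexing. -/
def Op.Canonical (n : ℕ) : Op G → Prop
  | silent => True
  | new i => i = n
  | gate1 _ i => i = 0
  | gate2 _ i j => i = 0 ∧ j = 1
  | meas i => i + 1 = n

/-- The effect of an operation on a normalized memory: weighted memories, each with the outcome
of a measurement. -/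
inductive MemStep : (o : Op G) → (n : ℕ) → QVec n →
    Multiset (ℝ × (Σ n, QVec n) × Fin 2) → Prop
  | silent (n : ℕ) (Q : QVec n) : MemStep .silent n Q {(1, ⟨n, Q⟩, 0)}
  | new (n : ℕ) (Q : QVec n) : MemStep (.new n) n Q {(1, ⟨n + 1, Q.tensorKet 0⟩, 0)}
  | gate1 (n : ℕ) (Q : QVec (n + 1)) (A : G.Unary) :
      MemStep (.gate1 A 0) (n + 1) Q {(1, ⟨n + 1, Q.apply1 (G.mat1 A).1⟩, 0)}
  | gate2 (n : ℕ) (Q : QVec (n + 2)) (A : G.Binary) :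
      MemStep (.gate2 A 0 1) (n + 2) Q {(1, ⟨n + 2, Q.apply2 (G.mat2 A).1⟩, 0)}
  | meas (n : ℕ) (Q : QVec (n + 1)) (α₀ α₁ : ℂ) (Q₀ Q₁ : QVec n)
      (norm₀ : ‖Q₀‖ = 1) (norm₁ : ‖Q₁‖ = 1)
      (decomp : Q = α₀ • Q₀.tensorKet 0 + α₁ • Q₁.tensorKet 1) :
      MemStep (.meas n) (n + 1) Q
        (({(‖α₀‖ ^ 2, ⟨n, Q₀⟩, 0), (‖α₁‖ ^ 2, ⟨n, Q₁⟩, 1)} :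
          Multiset (ℝ × (Σ n, QVec n) × Fin 2)).filter fun x => x.1 ≠ 0)

/-- The results of a step of a term, with the memories. -/
def attach (M₀ M₁ : Term G) (x : ℝ × (Σ n, QVec n) × Fin 2) : ℝ × Config G :=
  (x.1, ⟨x.2.1.1, x.2.1.2, if x.2.2 = 0 then M₀ else M₁⟩)

theorem CtxStep.congr {c : Config G} {d : Multiset (ℝ × Config G)} (h : CtxStep c d)
    (F : Term G → Term G) (hF : ∀ S : SurfCtx G, ∃ S' : SurfCtx G, ∀ M, S'.fill M = F (S.fill M)) :
    CtxStep ⟨c.size, c.mem, F c.term⟩ (d.map fun x => (x.1, ⟨x.2.size, x.2.mem, F x.2.term⟩)) := by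
  cases h with
  | beta n Q S M M' h =>
    obtain ⟨S', hS'⟩ := hF S
    have := CtxStep.beta n Q S' M M' h
    simpa only [hS', Multiset.map_singleton] using this
  | quantum n Q S M d h =>
    obtain ⟨S', hS'⟩ := hF S
    have := CtxStep.quantum n Q S' M d h
    simpa only [hS', Multiset.map_map, Function.comp_def] using this

theorem RootBeta.ctxStep {M M' : Term G} (h : RootBeta M M') (n : ℕ) (Q : QVec n) :
    CtxStep ⟨n, Q, M⟩ {(1, ⟨n, Q, M'⟩)} := .beta n Q .hole M M' h

theorem RootQuantum.ctxStep {n : ℕ} {Q : QVec n} {M : Term G} {d : Multiset (ℝ × Config G)}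
    (h : RootQuantum ⟨n, Q, M⟩ d) : CtxStep ⟨n, Q, M⟩ d := by
  simpa [SurfCtx.fill] using CtxStep.quantum n Q .hole M d h

/-- The effect on the memory is independent of the context, so `D` stays fixed during the induction
and each congruence rule only adds one layer of surface context. -/
theorem SurfRed.ctxStep {o : Op G} {M M₀ M₁ : Term G} (h : SurfRed o M M₀ M₁) {n : ℕ} {Q : QVec n}
    {D : Multiset (ℝ × (Σ n, QVec n) × Fin 2)} (hD : MemStep o n Q D) :
    CtxStep ⟨n, Q, M⟩ (D.map (attach M₀ M₁)) := by
  have layer : ∀ (F : Term G → Term G) {M M₀ M₁ : Term G},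
      (∀ S : SurfCtx G, ∃ S' : SurfCtx G, ∀ M, S'.fill M = F (S.fill M)) →
      CtxStep ⟨n, Q, M⟩ (D.map (attach M₀ M₁)) →
      CtxStep ⟨n, Q, F M⟩ (D.map (attach (F M₀) (F M₁))) := by
    intro F M M₀ M₁ hF h
    have := h.congr F hF
    rw [Multiset.map_map] at this
    convert this using 2
    rename_i x _
    simp only [attach, Function.comp, apply_ite F]
  induction h with
  | beta M N => cases hD; simpa [attach] using (RootBeta.lin M N).ctxStep n Q
  | bbeta M N => cases hD; simpa [attach] using (RootBeta.bang M N).ctxStep n Q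
  | new i => cases hD with | new _ Q => simpa [attach] using (RootQuantum.new _ Q).ctxStep
  | gate1 A i =>
    cases hD with | gate1 _ Q A => simpa [attach] using (RootQuantum.unary _ Q A).ctxStep
  | gate2 A i j => cases hD with | gate2 _ Q A => exact (RootQuantum.binary _ Q A).ctxStep
  | meas i M N =>
    cases hD with
    | meas _ Q α₀ α₁ Q₀ Q₁ h₀ h₁ decomp =>
      have := (RootQuantum.meas _ Q α₀ α₁ Q₀ Q₁ M N h₀ h₁ decomp).ctxStep
      convert this using 1
      have e : ({(‖α₀‖ ^ 2, ⟨_, Q₀, M⟩), (‖α₁‖ ^ 2, ⟨_, Q₁, N⟩)} : Multiset (ℝ × Config G)) =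
        Multiset.map (attach M N) {(‖α₀‖ ^ 2, ⟨_, Q₀⟩, 0), (‖α₁‖ ^ 2, ⟨_, Q₁⟩, 1)} := by
        simp [attach]
      rw [e, Multiset.filter_map]
      rfl
  | appL N _ ih => exact layer (fun M => app M N) (fun S => ⟨.appL S N, fun _ => rfl⟩) (ih hD)
  | appR M _ ih => exact layer (fun N => app M N) (fun S => ⟨.appR M S, fun _ => rfl⟩) (ih hD)
  | lam _ ih => exact layer Term.lam (fun S => ⟨.lam S, fun _ => rfl⟩) (ih hD)
  | blam _ ih => exact layer Term.blam (fun S => ⟨.blam S, fun _ => rfl⟩) (ih hD)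
  | measP M N _ ih =>
    exact layer (fun P => Term.meas P M N) (fun S => ⟨.meas S M N, fun _ => rfl⟩) (ih hD)

theorem exists_memStep {o : Op G} {n : ℕ} (hc : o.Canonical n) (hr : ∀ i ∈ o.reads, i < n)
    (Q : QVec n) (hQ : ‖Q‖ = 1) :
    ∃ D, MemStep o n Q D ∧ (∀ x ∈ D, 0 < x.1) ∧ (D.map Prod.fst).sum = 1 ∧
      ∀ x ∈ D, ‖x.2.1.2‖ = 1 ∧
        x.2.1.1 + o.consumed (fun _ => 1) = n + o.created fun _ => 1 := by
  cases o with
  | silent => exact ⟨_, .silent n Q, by simp, by simp, by simp [hQ, Op.consumed, Op.created]⟩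
  | new i =>
    cases hc
    exact ⟨_, .new _ Q, by simp, by simp,
      by simp [hQ, QVec.norm_tensorKet, Op.consumed, Op.created]⟩
  | gate1 A i =>
    cases hc
    have := hr 0 (by simp [Op.reads])
    obtain ⟨n, rfl⟩ : ∃ k, n = k + 1 := ⟨n - 1, by omega⟩
    exact ⟨_, .gate1 _ Q A, by simp, by simp,
      by simp [hQ, QVec.norm_apply1, Op.consumed, Op.created]⟩
  | gate2 A i j =>
    obtain ⟨rfl, rfl⟩ := hc
    have := hr 1 (by simp [Op.reads])
    obtain ⟨n, rfl⟩ : ∃ k, n = k + 2 := ⟨n - 2, by omega⟩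
    exact ⟨_, .gate2 _ Q A, by simp, by simp,
      by simp [hQ, QVec.norm_apply2, Op.consumed, Op.created]⟩
  | meas i =>
    cases hc
    obtain ⟨α₀, α₁, Q₀, Q₁, h₀, h₁, decomp, hs⟩ := QVec.exists_decomp Q hQ
    refine ⟨_, .meas _ Q α₀ α₁ Q₀ Q₁ h₀ h₁ decomp, ?_, ?_, ?_⟩
    · intro x hx
      rw [Multiset.mem_filter] at hx
      have : 0 ≤ x.1 := by
        have := hx.1
        simp only [Multiset.insert_eq_cons, Multiset.mem_cons, Multiset.mem_singleton] at this
        rcases this with rfl | rfl <;> positivity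
      exact lt_of_le_of_ne this (Ne.symm hx.2)
    · rw [← hs]
      by_cases z₀ : α₀ = 0 <;> by_cases z₁ : α₁ = 0 <;>
        simp [z₀, z₁, Multiset.insert_eq_cons, Multiset.filter_singleton]
    · intro x hx
      rw [Multiset.mem_filter] at hx
      have := hx.1
      simp only [Multiset.insert_eq_cons, Multiset.mem_cons, Multiset.mem_singleton] at this
      rcases this with rfl | rfl <;> simp [h₀, h₁, Op.consumed, Op.created]

theorem exists_map_toConfig (d : Multiset (ℝ × Config G))
    (h : ∀ x ∈ d, ∃ p : RawProgram G, p.toConfig = x.2) :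
    ∃ d' : Multiset (ℝ × RawProgram G), d'.map (fun x => (x.1, x.2.toConfig)) = d := by
  induction d using Multiset.induction with
  | empty => exact ⟨0, rfl⟩
  | cons a d ih =>
    obtain ⟨d', rfl⟩ := ih fun x hx => h x (Multiset.mem_cons_of_mem hx)
    obtain ⟨p, hp⟩ := h a (Multiset.mem_cons_self _ _)
    exact ⟨(a.1, p) ::ₘ d', by simp [hp]⟩

theorem RawProgram.exists_surfStep_of_canonical (p : RawProgram G) {o : Op G} {M₀ M₁ : Term G}
    (h : SurfRed o p.term M₀ M₁) (hc : o.Canonical p.size) : ∃ m, SurfStep p.toProgram m := by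
  have hr : ∀ i ∈ o.reads, i < p.size := fun i hi => (p.regs i).1 (h.regCount_pos hi)
  have hf : o.Fresh p.term := by
    intro i hi
    subst hi
    cases hc
    exact p.regCount_of_le le_rfl
  obtain ⟨D, hD, hpos, hsum, hx⟩ := exists_memStep hc hr p.mem p.norm_mem
  have hv := h.valid p.valid hf
  -- Canonical operations create register `n` or consume register `n - 1`, where `n` is the memory
  -- size, so the registers remain an initial segment of `ℕ`.
  have hregs : ∀ (k : ℕ) (N : Term G),
      k + o.consumed (fun _ => 1) = p.size + o.created (fun _ => 1) →
      (∀ i, N.regCount i + o.consumed (delta i) = p.term.regCount i + o.created (delta i)) →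
      ∀ i, 1 ≤ N.regCount i ↔ i < k := by
    intro k N hk hN i
    have hN := hN i
    have hp := p.regs i
    have hp1 := p.valid.1 i
    cases o with
    | new j =>
      cases hc
      simp only [Op.consumed, Op.created, delta] at hk hN
      split_ifs at hN <;> omega
    | meas j =>
      simp only [Op.consumed, Op.created, delta, Op.Canonical] at hk hN hc
      split_ifs at hN <;> omega
    | _ => simp only [Op.consumed, Op.created] at hk hN; omega
  obtain ⟨d, hd⟩ := exists_map_toConfig (D.map (attach M₀ M₁)) (by
    intro x hxD
    rw [Multiset.mem_map] at hxD
    obtain ⟨x, hxD, rfl⟩ := hxD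
    obtain ⟨hn, hk⟩ := hx x hxD
    have hreg := fun i => h.regCount_result p.valid i
    simp only [attach]
    split_ifs
    · exact ⟨⟨⟨_, _, _⟩, hn, hv.1, hregs _ _ hk fun i => (hreg i).1⟩, rfl⟩
    · exact ⟨⟨⟨_, _, _⟩, hn, hv.2, hregs _ _ hk fun i => (hreg i).2⟩, rfl⟩)
  have hfst : d.map Prod.fst = D.map Prod.fst := by
    have := congrArg (Multiset.map Prod.fst) hd
    simpa only [Multiset.map_map, Function.comp_def, attach] using this
  have hle : ∀ w ∈ D.map Prod.fst, 0 < w := by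
    intro w hw
    rw [Multiset.mem_map] at hw
    obtain ⟨x, hxD, rfl⟩ := hw
    exact hpos x hxD
  refine ⟨⟨d.map fun x => (x.1, x.2.toProgram), ?_, ?_⟩, p, d, rfl, ?_, rfl⟩
  · intro x hxd
    have hx' : x.1 ∈ D.map Prod.fst := by
      rw [← hfst]
      rw [Multiset.mem_map] at hxd
      obtain ⟨y, hy, rfl⟩ := hxd
      exact Multiset.mem_map_of_mem _ hy
    refine ⟨hle _ hx', ?_⟩
    rw [← hsum]
    exact Multiset.single_le_sum (fun w hw => (hle w hw).le) _ hx'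
  · rw [Multiset.map_map]
    change (d.map Prod.fst).sum ≤ 1
    rw [hfst, hsum]
  · rw [hd]
    exact h.ctxStep hD

/-- The re-indexing of a raw program. -/
def RawProgram.reindex (p : RawProgram G) (σ : Equiv.Perm (Fin p.size)) : RawProgram G where
  toConfig := p.toConfig.reindex σ
  norm_mem := (QVec.norm_permute σ p.mem).trans p.norm_mem
  valid := p.valid.mapReg (natPerm σ)
  regs i := by
    obtain ⟨i, rfl⟩ := (natPerm σ).surjective i
    exact (iff_of_eq (congrArg (1 ≤ ·) (regCount_mapReg (natPerm σ) i p.term))).trans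
      ((p.regs i).trans (natPerm_lt σ i).symm)

theorem RawProgram.toProgram_reindex (p : RawProgram G) (σ : Equiv.Perm (Fin p.size)) :
    (p.reindex σ).toProgram = p.toProgram :=
  Eq.symm (Quotient.sound ⟨σ, rfl⟩)

theorem natPerm_apply {n : ℕ} (σ : Equiv.Perm (Fin n)) (i : Fin n) : natPerm σ i = σ i := by
  simp [natPerm, extendPerm]

theorem SurfRed.ne_of_gate2 {A : G.Binary} {i j : ℕ} {M M₀ M₁ : Term G}
    (h : SurfRed (.gate2 A i j) M M₀ M₁) (hM : ∀ i, M.regCount i ≤ 1) : i ≠ j := by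
  rintro rfl
  have key : 2 ≤ M.regCount i := by
    clear hM
    generalize ho : Op.gate2 A i i = o at h
    induction h with
    | gate2 => cases ho; simp [regCount]
    | beta | bbeta | new | gate1 | meas => cases ho
    | _ => rename_i ih; have := ih ho; simp only [regCount]; omega
  have := hM i
  omega

/-- The root rules only mention `r₀`, `r₁` or the last register; a suitable representative of the
program brings the registers of the redex there. -/
theorem RawProgram.exists_surfStep (p : RawProgram G) (h : p.term.Reducible) :
    ∃ m, SurfStep p.toProgram m := by
  obtain ⟨o, M₀, M₁, h, ho⟩ := h
  have hr : ∀ i ∈ o.reads, i < p.size := fun i hi => (p.regs i).1 (h.regCount_pos hi)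
  have main : ∀ σ : Equiv.Perm (Fin p.size), (o.mapReg (natPerm σ)).Canonical p.size →
      ∃ m, SurfStep p.toProgram m := by
    intro σ hσ
    rw [← p.toProgram_reindex σ]
    exact (p.reindex σ).exists_surfStep_of_canonical (h.mapReg (natPerm σ)) hσ
  cases o with
  | silent => exact p.exists_surfStep_of_canonical h trivial
  | new i =>
    -- Here the program is not re-indexed: only the name of the created register changes.
    have h' := h.mapReg (Equiv.swap i p.size)
    rw [SurfRed.mapReg_swap_of_fresh (ho i rfl) (p.regCount_of_le le_rfl)] at h'
    exact p.exists_surfStep_of_canonical h' (Equiv.swap_apply_left _ _)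
  | gate1 A i =>
    have hi := hr i (by simp [Op.reads])
    refine main (Equiv.swap ⟨i, hi⟩ ⟨0, by omega⟩) ?_
    have := natPerm_apply (Equiv.swap (⟨i, hi⟩ : Fin p.size) ⟨0, by omega⟩) ⟨i, hi⟩
    rw [Equiv.swap_apply_left] at this
    exact this
  | gate2 A i j =>
    have hi := hr i (by simp [Op.reads])
    have hj := hr j (by simp [Op.reads])
    have hij := h.ne_of_gate2 p.valid.1
    let a : Fin p.size := ⟨i, hi⟩
    let b : Fin p.size := ⟨j, hj⟩
    let z : Fin p.size := ⟨0, by omega⟩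
    let o : Fin p.size := ⟨1, by omega⟩
    have hab : a ≠ b := fun e => hij (congrArg Fin.val e)
    have hzo : z ≠ o := fun e => by simp [z, o] at e
    -- First `a` is sent to 0, then the image of `b` to 1. The second swap does not move 0, because
    -- `a ≠ b`.
    let σ : Equiv.Perm (Fin p.size) := Equiv.swap (Equiv.swap a z b) o * Equiv.swap a z
    have ha : σ a = z := by
      have h1 : Equiv.swap a z b ≠ z := fun e => hab
        ((Equiv.swap a z).injective (e.trans (Equiv.swap_apply_left a z).symm)).symm
      simp only [σ, Equiv.Perm.mul_apply, Equiv.swap_apply_left]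
      exact Equiv.swap_apply_of_ne_of_ne h1.symm hzo
    have hb : σ b = o := by simp only [σ, Equiv.Perm.mul_apply, Equiv.swap_apply_left]
    refine main σ ⟨?_, ?_⟩
    · exact (natPerm_apply σ a).trans (by rw [ha])
    · exact (natPerm_apply σ b).trans (by rw [hb])
  | meas i =>
    have hi := hr i (by simp [Op.reads])
    refine main (Equiv.swap ⟨i, hi⟩ ⟨p.size - 1, by omega⟩) ?_
    have := natPerm_apply (Equiv.swap (⟨i, hi⟩ : Fin p.size) ⟨p.size - 1, by omega⟩) ⟨i, hi⟩
    rw [Equiv.swap_apply_left] at this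
    change natPerm _ i + 1 = _
    rw [this]
    simp only
    omega

/-! ### Random descent -/

theorem RawProgram.isSnf_iff (p : RawProgram G) : IsSnf p.toProgram ↔ ¬ p.term.Reducible := by
  constructor
  · intro h hr
    obtain ⟨m, hm⟩ := p.exists_surfStep hr
    exact h m hm
  · rintro h m ⟨q, d, hq, hd, -⟩
    obtain ⟨σ, hσ⟩ : ∃ σ : Equiv.Perm (Fin q.size), p.toConfig = q.toConfig.reindex σ :=
      Quotient.exact hq
    apply h
    rw [hσ]
    exact hd.sum_value.1.mapReg (natPerm σ)

theorem Program.value_of_isSnf {e : Program G} (h : IsSnf e) (k : ℕ) : e.value k = 1 := by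
  induction e using Quotient.inductionOn with
  | h p =>
    have := value_of_not_reducible (Q := p.mem.embed) (p.isSnf_iff.1 h) k
    rw [QVec.normSq_embed, p.norm_mem, one_pow] at this
    exact this

theorem Program.value_zero_of_not_isSnf {e : Program G} (h : ¬ IsSnf e) : e.value 0 = 0 := by
  induction e using Quotient.inductionOn with
  | h p =>
    have hr : p.term.Reducible := by
      by_contra hr
      exact h (p.isSnf_iff.2 hr)
    exact value_zero_of_reducible hr

theorem Program.value_le_succ (k : ℕ) (e : Program G) : e.value k ≤ e.value (k + 1) := by
  induction e using Quotient.inductionOn with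
  | h p => exact QLam.value_le_succ k _ _

/-- The expected value of a multiset of weighted programs. -/
def expValue (k : ℕ) : Multiset (ℝ × Program G) →+ ℝ where
  toFun m := (m.map fun x => x.1 * x.2.value k).sum
  map_zero' := rfl
  map_add' m n := by simp

theorem expValue_apply (k : ℕ) (m : Multiset (ℝ × Program G)) :
    expValue k m = (m.map fun x => x.1 * x.2.value k).sum := rfl

theorem expValue_scale (k : ℕ) (p : ℝ) (m : Multiset (ℝ × Program G)) :
    expValue k (scale p m) = p * expValue k m := by
  simp [expValue_apply, scale, Multiset.map_map, mul_assoc, Multiset.sum_map_mul_left]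

theorem StrictOne.expValue {e : Program G} {d : Multiset (ℝ × Program G)} (h : StrictOne e d)
    (k : ℕ) : expValue k d = e.value (k + 1) := by
  cases h with
  | stay h => simp [expValue_apply, Program.value_of_isSnf h]
  | step m h => exact h.sum_value k

/-- A strict step uses up one unit of the step count on every component: normal forms have constant
value 1, and other programs step with any redex at no loss. -/
theorem StrictRed.expValue {m n : MDist (Program G)} (h : StrictRed m n) (k : ℕ) :
    expValue k n.val = expValue (k + 1) m.val := by
  obtain ⟨l, p, e, d, h, hm, hn⟩ := h
  rw [hn, hm, map_sum]
  simp only [expValue_scale, (h _).expValue]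
  rw [expValue_apply, Multiset.map_map]
  rfl

theorem probSnf_eq (m : MDist (Program G)) : probSnf m = expValue 0 m.val := by
  rw [probSnf]
  refine congrArg Multiset.sum (Multiset.map_congr rfl fun x _ => ?_)
  split_ifs with h
  · rw [Program.value_of_isSnf h, mul_one]
  · rw [Program.value_zero_of_not_isSnf h, mul_zero]

theorem probSnf_mem_Icc (m : MDist (Program G)) : probSnf m ∈ Set.Icc (0 : ℝ) 1 := by
  rw [probSnf]
  constructor
  · refine Multiset.sum_nonneg fun w hw => ?_
    obtain ⟨x, hx, rfl⟩ := Multiset.mem_map.1 hw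
    have := (m.mem_Ioc x hx).1
    split_ifs <;> linarith
  · refine le_trans (Multiset.sum_map_le_sum_map _ _ fun x hx => ?_) m.sum_le_one
    have := (m.mem_Ioc x hx).1
    split_ifs <;> linarith

theorem expValue_le_succ (k : ℕ) (m : MDist (Program G)) :
    expValue k m.val ≤ expValue (k + 1) m.val :=
  Multiset.sum_map_le_sum_map _ _ fun x hx =>
    mul_le_mul_of_nonneg_left (x.2.value_le_succ k) (m.mem_Ioc x hx).1.le

theorem IsStrictSeqFrom.probSnf_eq {m : MDist (Program G)} {s : ℕ → MDist (Program G)}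
    (h : IsStrictSeqFrom m s) (k : ℕ) : probSnf (s k) = expValue k m.val := by
  have key : ∀ k l, expValue l (s k).val = expValue (k + l) m.val := by
    intro k
    induction k with
    | zero => intro l; rw [h.1, zero_add]
    | succ k ih => intro l; rw [(h.2 k).expValue, ih]; congr 2; omega
  rw [QLam.probSnf_eq, key, add_zero]

end QLam

end

theorem mainTheorem5 (G : QLam.GateSet.{u}) (m : QLam.MDist (QLam.Program G)) :
    ∃ q ∈ Set.Icc (0 : ℝ) 1, ∀ s : ℕ → QLam.MDist (QLam.Program G),
      QLam.IsStrictSeqFrom m s → QLam.ConvergesWith s q := by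
  by_cases hs : ∃ s, QLam.IsStrictSeqFrom m s
  · obtain ⟨s₀, h₀⟩ := hs
    let v : ℕ → ℝ := fun k => QLam.expValue k m.val
    -- The bounds are read off an actual sequence, where the values are sums of part of the weights
    -- of a multidistribution.
    have hv : ∀ k, v k ∈ Set.Icc (0 : ℝ) 1 := fun k => by
      rw [← show QLam.probSnf (s₀ k) = v k from h₀.probSnf_eq k]
      exact QLam.probSnf_mem_Icc _
    have hmono : Monotone v := monotone_nat_of_le_succ fun k => QLam.expValue_le_succ k m
    have hbdd : BddAbove (Set.range v) := ⟨1, by rintro _ ⟨k, rfl⟩; exact (hv k).2⟩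
    refine ⟨⨆ k, v k, ⟨(hv 0).1.trans (le_ciSup hbdd 0), ciSup_le fun k => (hv k).2⟩,
      fun s h => ?_⟩
    have e : (fun k => QLam.probSnf (s k)) = v := funext h.probSnf_eq
    rw [QLam.ConvergesWith, e]
    exact ⟨isLUB_ciSup hbdd, tendsto_atTop_ciSup hmono hbdd⟩
  -- Without any sequence from `m` the claim is vacuous, and 0 is an arbitrary choice.
  · exact ⟨0, by simp, fun s h => absurd ⟨s, h⟩ hs⟩
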